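/- Let $G$ be an infinite group, let $S$ be a finite symmetric generating set of $G$ and let $1<p<\infty$ be a real number. Notation. For $f\colon G\to\mathbb C$ and $x\in G$ let $f_x(g)=f(gx^{-1})$ be the right translate of $f$ by $x$. Let $D_p(G)$ be the space of all $f\colon G\to\mathbb C$ such that $\sum_{g\in G}|f(gs^{-1})-f(g)|^p<\infty$ for all $s\in S$, with the pseudonorm $\|f\|=\bigl(\sum_{s\in S}\sum_{g\in G}|f(gs^{-1})-f(g)|^p\bigr)^{1/p}$ and the norm $\|f\|_{D_p}=(\|f\|^p+|f(e)|^p)^{1/p}$, where $e$ is the identity of $G$. Identify $\mathbb C$ with the constant functions; $D_p(G)/\mathbb C$ carries the norm induced by $\|\cdot\|$. The first reduced $\ell^p$-cohomology of $G$ is $\bar H^1_{(p)}(G)=D_p(G)/\overline{\ell^p(G)\oplus\mathbb C}$, with the closure taken in $(D_p(G),\|\cdot\|_{D_p})$. Let $BD_p(G)$ be the algebra, under pointwise operations, of bounded functions in $D_p(G)$, and let $Sp(BD_p(G))$ be the set of its characters (nonzero homomorphisms to $\mathbb C$), in which $g\in G$ is identified with the evaluation $f\mapsto f(g)$. The $p$-harmonic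 boundary $\partial_p(G)$ is the set of all characters $\chi\in Sp(BD_p(G))\setminus G$ such that $\chi(f)=0$ for every bounded $f$ in the closure, in $(D_p(G),\|\cdot\|_{D_p})$, of the finitely supported functions. Let $HD_p(G)$ be the set of all $f\in D_p(G)$ such that $\sum_{s\in S}|f(gs^{-1})-f(g)|^{p-2}(f(gs^{-1})-f(g))=0$ for all $g\in G$, where a term with $f(gs^{-1})=f(g)$ is $0$, and let $BHD_p(G)$ be the set of bounded functions in $HD_p(G)$. A translation invariant linear functional (TILF) on $D_p(G)/\mathbb C$ is a linear map $T\colon D_p(G)/\mathbb C\to\mathbb C$ such that $T([f_x])=T([f])$ for all $f\in D_p(G)$ and $x\in G$. Theorem. The following are equivalent: 1. $\bar H^1_{(p)}(G)=0$; 2. $\partial_p(G)$ is empty or consists of a single point; 3. $HD_p(G)=\mathbb C$; 4. $BHD_p(G)=\mathbb C$; 5. the only continuous TILF on $D_p(G)/\mathbb C$ is zero. If moreover $G$ is nonamenable (that is, there is no left invariant finitely additive probability measure defined on all subsets of $G$), then these are also equivalent to: 6. zero is the only TILF on $D_p(G)/\mathbb C$. -/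

import Mathlib

open scoped ENNReal Pointwise

set_option linter.unusedSectionVars false

noncomputable section

namespace PHarmonic

/-- A finite symmetric generating set of a group. -/
structure SymmGenSet (G : Type*) [Group G] where
  carrier : Finset G
  inv_mem : ∀ s ∈ carrier, s⁻¹ ∈ carrier
  closure_eq_top : Subgroup.closure (carrier : Set G) = ⊤

section Basic

variable {G : Type*} [Group G]

/-- `∑ |u i| ^ p < ∞`. -/
def PSummable {ι : Type*} (p : ℝ) (u : ι → ℂ) : Prop :=
  Summable fun i => ‖u i‖ ^ p

/-- The difference `g ↦ f (g s⁻¹) - f g`. -/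
def diff (s : G) (f : G → ℂ) : G → ℂ := fun g => f (g * s⁻¹) - f g

/-- `f` is a bounded function. -/
def IsBdd (f : G → ℂ) : Prop := ∃ C : ℝ, ∀ g, ‖f g‖ ≤ C

/-- A discrete group is amenable if it carries a finitely additive left invariant probability
measure defined on all subsets. -/
def IsAmenable (G : Type*) [Group G] : Prop :=
  ∃ m : Set G → ℝ≥0∞, m Set.univ = 1 ∧
    (∀ s t : Set G, Disjoint s t → m (s ∪ t) = m s + m t) ∧
    ∀ (g : G) (s : Set G), m (g • s) = m s

theorem pSummable_iff_memlp {ι : Type*} (p : ℝ) [hp : Fact (1 ≤ p)] (u : ι → ℂ) :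
    PSummable p u ↔ Memℓp u (ENNReal.ofReal p) := by
  have h0 : 0 < p := lt_of_lt_of_le one_pos hp.out
  have h1 : (ENNReal.ofReal p).toReal = p := ENNReal.toReal_ofReal h0.le
  rw [memℓp_gen_iff (by rw [h1]; exact h0), h1, PSummable]

variable {p : ℝ} [hp : Fact (1 ≤ p)]

theorem PSummable.add {ι : Type*} {u v : ι → ℂ} (hu : PSummable p u) (hv : PSummable p v) :
    PSummable p (u + v) := by
  rw [pSummable_iff_memlp] at *
  exact hu.add hv

theorem PSummable.const_smul {ι : Type*} {u : ι → ℂ} (hu : PSummable p u) (c : ℂ) :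
    PSummable p (c • u) := by
  rw [pSummable_iff_memlp] at *
  exact hu.const_smul c

theorem PSummable.zero {ι : Type*} : PSummable p (0 : ι → ℂ) := by
  rw [pSummable_iff_memlp]
  exact zero_memℓp

theorem PSummable.sub {ι : Type*} {u v : ι → ℂ} (hu : PSummable p u) (hv : PSummable p v) :
    PSummable p (u - v) := by
  rw [pSummable_iff_memlp] at *
  exact hu.sub hv

theorem PSummable.bdd_mul {u v : G → ℂ} (hu : PSummable p u) (hv : IsBdd v) :
    PSummable p (v * u) := by
  obtain ⟨C, hC⟩ := hv
  have h0 : 0 < p := lt_of_lt_of_le one_pos hp.out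
  have hC0 : 0 ≤ C := (norm_nonneg _).trans (hC 1)
  refine Summable.of_nonneg_of_le (fun g => by positivity) (fun g => ?_)
    (Summable.mul_left (C ^ p) hu)
  rw [Pi.mul_apply, norm_mul, Real.mul_rpow (norm_nonneg _) (norm_nonneg _)]
  gcongr
  exact hC g

theorem PSummable.translate {u : G → ℂ} (hu : PSummable p u) (x : G) :
    PSummable p (fun g => u (g * x)) :=
  (Equiv.mulRight x).summable_iff.mpr hu

theorem PSummable.diff {u : G → ℂ} (hu : PSummable p u) (x : G) : PSummable p (diff x u) :=
  (hu.translate x⁻¹).sub hu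

theorem pSummable_of_finite_support {u : G → ℂ} (hu : u.support.Finite) : PSummable p u := by
  have h0 : 0 < p := lt_of_lt_of_le one_pos hp.out
  refine summable_of_hasFiniteSupport (hu.subset fun g hg => ?_)
  intro h
  simp [h, Real.zero_rpow h0.ne'] at hg

end Basic

section Spaces

variable {G : Type*} [Group G] (S : SymmGenSet G) (p : ℝ) [hp : Fact (1 ≤ p)]

/-- `D_p(G)` as a linear space of functions. -/
def dirichletSubmodule : Submodule ℂ (G → ℂ) where
  carrier := {f | ∀ s ∈ S.carrier, PSummable p (diff s f)}
  add_mem' {a b} ha hb s hs := by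
    have : diff s (a + b) = diff s a + diff s b := by
      ext g; simp only [diff, Pi.add_apply]; ring
    rw [this]; exact (ha s hs).add (hb s hs)
  zero_mem' s _ := by
    have : diff s (0 : G → ℂ) = 0 := by ext g; simp [diff]
    rw [this]; exact PSummable.zero
  smul_mem' c f hf s hs := by
    have : diff s (c • f) = c • diff s f := by
      ext g; simp only [diff, Pi.smul_apply, smul_eq_mul]; ring
    rw [this]; exact (hf s hs).const_smul c

/-- `D_p(G)` as a type of its own, so that it carries the topology of the norm defined below and
not the topology of pointwise convergence. -/
def Dp : Type _ := ↥(dirichletSubmodule S p)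

instance : AddCommGroup (Dp S p) := inferInstanceAs (AddCommGroup (dirichletSubmodule S p))

instance : Module ℂ (Dp S p) := inferInstanceAs (Module ℂ (dirichletSubmodule S p))

variable {S p}

/-- The function underlying an element of `D_p(G)`. -/
def Dp.fn (f : Dp S p) : G → ℂ := Subtype.val (p := (· ∈ dirichletSubmodule S p)) f

/-- A function in `D_p(G)` as an element of the type `Dp S p`. -/
def Dp.of (u : G → ℂ) (hu : u ∈ dirichletSubmodule S p) : Dp S p :=
  (⟨u, hu⟩ : dirichletSubmodule S p)

instance : CoeFun (Dp S p) fun _ => G → ℂ := ⟨Dp.fn⟩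

theorem Dp.mem (f : Dp S p) : (f : G → ℂ) ∈ dirichletSubmodule S p :=
  Subtype.prop (p := (· ∈ dirichletSubmodule S p)) f

theorem Dp.of_apply (u : G → ℂ) (hu : u ∈ dirichletSubmodule S p) (g : G) :
    Dp.of u hu g = u g := rfl

theorem Dp.ext {f h : Dp S p} (H : ∀ g, f g = h g) : f = h := Subtype.ext (funext H)

theorem Dp.add_apply (f h : Dp S p) (g : G) : (f + h) g = f g + h g := rfl

theorem Dp.smul_apply (c : ℂ) (f : Dp S p) (g : G) : (c • f) g = c * f g := rfl

theorem Dp.zero_apply (g : G) : (0 : Dp S p) g = 0 := rfl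

/-- `‖f‖ ^ p = ∑ s ∈ S, ∑ g, |f (g s⁻¹) - f g| ^ p`, the `p`-th power of the pseudonorm. -/
def energy (f : Dp S p) : ℝ := ∑ s ∈ S.carrier, ∑' g, ‖diff s f g‖ ^ p

/-- The norm `(‖f‖ ^ p + |f e| ^ p) ^ (1 / p)` of `D_p(G)`. -/
instance : Norm (Dp S p) := ⟨fun f => (energy f + ‖f 1‖ ^ p) ^ (1 / p)⟩

theorem Dp.norm_def (f : Dp S p) : ‖f‖ = (energy f + ‖f 1‖ ^ p) ^ (1 / p) := rfl

theorem energy_nonneg (f : Dp S p) : 0 ≤ energy f :=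
  Finset.sum_nonneg fun _ _ => tsum_nonneg fun _ => by positivity

theorem diff_add (s : G) (f h : Dp S p) :
    diff s (f + h : Dp S p) = diff s f + diff s h := by
  ext g; simp only [diff, Pi.add_apply, Dp.add_apply]; ring

theorem diff_smul (s : G) (c : ℂ) (f : Dp S p) :
    diff s (c • f : Dp S p) = c • diff s f := by
  ext g; simp only [diff, Pi.smul_apply, Dp.smul_apply, smul_eq_mul]; ring

theorem energy_eq_zero {f : Dp S p} (h : energy f = 0) (g : G) : f g = f 1 := by
  have h0 : 0 < p := lt_of_lt_of_le one_pos hp.out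
  have key : ∀ s ∈ S.carrier, ∀ g, f (g * s⁻¹) = f g := by
    intro s hs g
    have h1 := (Finset.sum_eq_zero_iff_of_nonneg
      (fun _ _ => tsum_nonneg fun _ => by positivity)).1 h s hs
    have h2 := ((hasSum_zero_iff_of_nonneg (fun g => by positivity)).1
      (h1 ▸ (f.mem s hs : Summable _).hasSum))
    have h3 := congrFun h2 g
    simp only [Pi.zero_apply] at h3
    rw [Real.rpow_eq_zero (norm_nonneg _) h0.ne', norm_eq_zero] at h3
    exact sub_eq_zero.1 h3
  have : ∀ x ∈ Subgroup.closure (S.carrier : Set G), ∀ g, f (g * x) = f g := by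
    intro x hx
    induction hx using Subgroup.closure_induction with
    | mem x hx => intro g; have := key x⁻¹ (S.inv_mem x hx) g; rwa [inv_inv] at this
    | one => simp
    | mul x y _ _ hx hy => intro g; rw [← mul_assoc, hy, hx]
    | inv x _ hx => intro g; rw [← hx (g * x⁻¹)]; simp
  simpa using this g (by rw [S.closure_eq_top]; trivial) 1

theorem Dp.core : NormedSpace.Core ℂ (Dp S p) := by
  have h0 : 0 < p := lt_of_lt_of_le one_pos hp.out
  refine { norm_nonneg := ?_, norm_smul := ?_, norm_triangle := ?_, norm_eq_zero_iff := ?_ }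
  · intro f
    rw [Dp.norm_def]
    have := energy_nonneg f
    positivity
  · intro c f
    have h1 : energy (c • f) = ‖c‖ ^ p * energy f := by
      simp only [energy, diff_smul, Pi.smul_apply, norm_smul,
        Real.mul_rpow (norm_nonneg _) (norm_nonneg _), tsum_mul_left, Finset.mul_sum]
    have h2 := energy_nonneg f
    rw [Dp.norm_def, Dp.norm_def, h1, Dp.smul_apply, norm_mul,
      Real.mul_rpow (norm_nonneg _) (norm_nonneg _), ← mul_add,
      Real.mul_rpow (by positivity) (by positivity), ← Real.rpow_mul (norm_nonneg _),
      mul_one_div_cancel h0.ne', Real.rpow_one]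
  · intro f h
    let a : Dp S p → Option S.carrier → ℝ := fun f o =>
      o.elim ‖f 1‖ fun s => (∑' g, ‖diff s.1 f g‖ ^ p) ^ (1 / p)
    have ha : ∀ f o, 0 ≤ a f o := by
      intro f o
      cases o with
      | none => exact norm_nonneg _
      | some s => exact Real.rpow_nonneg (tsum_nonneg fun _ => by positivity) _
    have hn : ∀ f : Dp S p, ‖f‖ = (∑ o, a f o ^ p) ^ (1 / p) := by
      intro f
      rw [Dp.norm_def, Fintype.sum_option, add_comm]
      congr 2
      rw [energy, ← Finset.sum_coe_sort]
      refine Finset.sum_congr rfl fun s _ => ?_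
      change _ = ((_ : ℝ) ^ (1 / p)) ^ p
      rw [← Real.rpow_mul (tsum_nonneg fun _ => by positivity), one_div_mul_cancel h0.ne',
        Real.rpow_one]
    have hadd : ∀ o, a (f + h) o ≤ a f o + a h o := by
      intro o
      cases o with
      | none => exact norm_add_le _ _
      | some s =>
        change (∑' g, ‖diff s.1 (f + h : Dp S p) g‖ ^ p) ^ (1 / p) ≤
          (∑' g, ‖diff s.1 f g‖ ^ p) ^ (1 / p) + (∑' g, ‖diff s.1 h g‖ ^ p) ^ (1 / p)
        have hM := Real.Lp_add_le_tsum_of_nonneg hp.out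
          (fun g => norm_nonneg (diff s.1 f g)) (fun g => norm_nonneg (diff s.1 h g))
          (f.mem s.1 s.2) (h.mem s.1 s.2)
        refine le_trans ?_ hM.2
        refine Real.rpow_le_rpow (tsum_nonneg fun _ => by positivity) ?_ (by positivity)
        refine Summable.tsum_le_tsum (fun g => ?_) ((f + h).mem s.1 s.2) hM.1
        rw [diff_add]
        exact Real.rpow_le_rpow (norm_nonneg _) (norm_add_le _ _) h0.le
    rw [hn, hn, hn]
    refine le_trans ?_ (Real.Lp_add_le_of_nonneg Finset.univ hp.out
      (fun o _ => ha f o) (fun o _ => ha h o))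
    refine Real.rpow_le_rpow (Finset.sum_nonneg fun o _ => Real.rpow_nonneg (ha _ o) _) ?_
      (by positivity)
    exact Finset.sum_le_sum fun o _ => Real.rpow_le_rpow (ha _ o) (hadd o) h0.le
  · intro f
    have h1 := energy_nonneg f
    have h2 : 0 ≤ ‖f 1‖ ^ p := by positivity
    constructor
    · intro h
      rw [Dp.norm_def, Real.rpow_eq_zero (by positivity) (by positivity)] at h
      have h3 : energy f = 0 := by linarith
      have h4 : ‖f 1‖ ^ p = 0 := by linarith
      rw [Real.rpow_eq_zero (norm_nonneg _) h0.ne', norm_eq_zero] at h4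
      exact Dp.ext fun g => by rw [energy_eq_zero h3 g, h4, Dp.zero_apply]
    · rintro rfl
      have h3 : ∀ s, diff s (0 : Dp S p) = 0 := fun s => by ext g; simp [diff, Dp.zero_apply]
      simp [Dp.norm_def, energy, h3, Dp.zero_apply, Real.zero_rpow h0.ne',
        Real.zero_rpow (inv_ne_zero h0.ne')]

instance : NormedAddCommGroup (Dp S p) := NormedAddCommGroup.ofCore Dp.core

instance : NormedSpace ℂ (Dp S p) := NormedSpace.ofCore Dp.core

theorem PSummable.mem_dirichlet {u : G → ℂ} (hu : PSummable p u) :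
    u ∈ dirichletSubmodule S p := fun s _ => hu.diff s

theorem const_mem_dirichlet (c : ℂ) : (fun _ => c) ∈ dirichletSubmodule S p := by
  intro s _
  have : diff s (fun _ : G => c) = 0 := by ext g; simp [diff]
  rw [this]; exact PSummable.zero

variable (S p)

/-- The constant functions, as a subspace of `D_p(G)`. -/
def constants : Submodule ℂ (Dp S p) where
  carrier := {f | ∃ c : ℂ, ∀ g, f g = c}
  add_mem' := by
    rintro a b ⟨c, hc⟩ ⟨d, hd⟩
    exact ⟨c + d, fun g => by rw [Dp.add_apply, hc, hd]⟩
  zero_mem' := ⟨0, fun _ => rfl⟩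
  smul_mem' := by
    rintro r a ⟨c, hc⟩
    exact ⟨r * c, fun g => by rw [Dp.smul_apply, hc]⟩

/-- `ℓ^p(G)` as a subspace of `D_p(G)`; see `PSummable.mem_dirichlet` for the inclusion. -/
def ellp : Submodule ℂ (Dp S p) where
  carrier := {f | PSummable p (f : G → ℂ)}
  add_mem' ha hb := PSummable.add ha hb
  zero_mem' := PSummable.zero
  smul_mem' c _ hf := PSummable.const_smul hf c

/-- The finitely supported functions, as a subset of `D_p(G)`. -/
def finSupp : Set (Dp S p) := {f | (Function.support (f : G → ℂ)).Finite}

/-- The first reduced `ℓ^p`-cohomology of `G`. -/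
abbrev reducedH1 : Type _ := Dp S p ⧸ (ellp S p ⊔ constants S p).topologicalClosure

/-- The algebra `BD_p(G)` of bounded functions in `D_p(G)`, with pointwise operations. -/
def BDp : Subalgebra ℂ (G → ℂ) where
  carrier := {f | f ∈ dirichletSubmodule S p ∧ IsBdd f}
  add_mem' := by
    rintro a b ⟨ha, C, hC⟩ ⟨hb, D, hD⟩
    exact ⟨add_mem ha hb, C + D, fun g => (norm_add_le _ _).trans (add_le_add (hC g) (hD g))⟩
  mul_mem' := by
    rintro a b ⟨ha, C, hC⟩ ⟨hb, D, hD⟩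
    refine ⟨fun s hs => ?_, C * D, fun g => ?_⟩
    · have : diff s (a * b) = (fun g => a (g * s⁻¹)) * diff s b + b * diff s a := by
        ext g; simp only [diff, Pi.add_apply, Pi.mul_apply]; ring
      rw [this]
      exact ((hb s hs).bdd_mul ⟨C, fun g => hC _⟩).add ((ha s hs).bdd_mul ⟨D, hD⟩)
    · rw [Pi.mul_apply, norm_mul]
      exact mul_le_mul (hC g) (hD g) (norm_nonneg _) ((norm_nonneg _).trans (hC g))
  algebraMap_mem' c := ⟨const_mem_dirichlet c, ‖c‖, fun _ => le_rfl⟩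

variable {S p}

/-- A bounded function in `D_p(G)`, seen as an element of `D_p(G)`. -/
def BDp.toDp (f : BDp S p) : Dp S p := Dp.of f.1 f.2.1

variable (S p)

/-- The characters of `BD_p(G)`. A homomorphism to `ℂ` is nonzero exactly when it is unital. -/
abbrev Sp : Type _ := BDp S p →ₐ[ℂ] ℂ

/-- The evaluation character `f ↦ f g`. -/
def evalChar (g : G) : Sp S p :=
  (Pi.evalAlgHom ℂ (fun _ : G => ℂ) g).comp (BDp S p).val

/-- The `p`-harmonic boundary of `G`: the characters of `BD_p(G)` which are not evaluations at
elements of `G` and which vanish on every bounded function in the closure, in `D_p(G)`, of the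
finitely supported functions. -/
def harmonicBoundary : Set (Sp S p) :=
  {x | x ∉ Set.range (evalChar S p) ∧
    ∀ f : BDp S p, BDp.toDp f ∈ closure (finSupp S p) → x f = 0}

/-- The `p`-Laplacian. A term with `f (g s⁻¹) = f g` is zero, for every `p`. -/
def pLaplacian (f : G → ℂ) (g : G) : ℂ :=
  ∑ s ∈ S.carrier, ((‖f (g * s⁻¹) - f g‖ ^ (p - 2) : ℝ) : ℂ) * (f (g * s⁻¹) - f g)

/-- The `p`-harmonic functions on `G`. -/
def HDp : Set (G → ℂ) := {f | f ∈ dirichletSubmodule S p ∧ ∀ g, pLaplacian S p f g = 0}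

/-- The bounded `p`-harmonic functions on `G`. -/
def BHDp : Set (G → ℂ) := {f | f ∈ HDp S p ∧ IsBdd f}

/-- `D_p(G)/ℂ`, with the quotient norm and topology. -/
abbrev DpModC : Type _ := Dp S p ⧸ constants S p

variable {S p}

/-- The class in `D_p(G)/ℂ` of a function in `D_p(G)`. -/
abbrev Dp.toModC (f : Dp S p) : DpModC S p := (constants S p).mkQ f

/-- The norm of `D_p(G)/ℂ` is the one induced from the pseudonorm of `D_p(G)`. -/
theorem norm_toModC (f : Dp S p) : ‖f.toModC‖ = energy f ^ (1 / p) := by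
  have h0 : 0 < p := lt_of_lt_of_le one_pos hp.out
  have key : ∀ c ∈ constants S p, energy (f + c) = energy f := by
    rintro c ⟨d, hd⟩
    have : ∀ s, diff s c = 0 := fun s => by ext g; simp [diff, hd]
    simp [energy, diff_add, this]
  have hE := energy_nonneg f
  refine (quotient_norm_mk_eq (constants S p).toAddSubgroup f).trans ?_
  apply le_antisymm
  · refine csInf_le ⟨0, ?_⟩ ?_
    · rintro _ ⟨c, _, rfl⟩
      exact norm_nonneg _
    · have hc : Dp.of (fun _ => -f 1) (const_mem_dirichlet _) ∈ constants S p :=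
        ⟨-f 1, fun _ => rfl⟩
      refine ⟨_, hc, ?_⟩
      change ‖f + _‖ = _
      rw [Dp.norm_def, key _ hc, Dp.add_apply, Dp.of_apply]
      simp [Real.zero_rpow h0.ne']
  · refine le_csInf ⟨_, 0, zero_mem _, rfl⟩ ?_
    rintro _ ⟨c, hc, rfl⟩
    change _ ≤ ‖f + c‖
    rw [Dp.norm_def, key c hc]
    exact Real.rpow_le_rpow hE (le_add_of_nonneg_right (by positivity)) (by positivity)

theorem diff_pSummable (f : Dp S p) (x : G) : PSummable p (diff x f) := by
  have hx : x ∈ Subgroup.closure (S.carrier : Set G) := by rw [S.closure_eq_top]; trivial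
  induction hx using Subgroup.closure_induction with
  | mem x hx => exact f.mem x hx
  | one =>
    have : diff 1 (f : G → ℂ) = 0 := by ext g; simp [diff]
    rw [this]; exact PSummable.zero
  | mul x y _ _ hx hy =>
    have : diff (x * y) (f : G → ℂ) = (fun g => diff x f (g * y⁻¹)) + diff y f := by
      ext g; simp [diff, mul_assoc]
    rw [this]; exact (hx.translate y⁻¹).add hy
  | inv x _ hx =>
    have : diff x⁻¹ (f : G → ℂ) = (-1 : ℂ) • fun g => diff x f (g * x) := by
      ext g; simp [diff]
    rw [this]; exact (hx.translate x).const_smul _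

/-- The right translate `f_x : g ↦ f (g x⁻¹)` of an element of `D_p(G)`. -/
def Dp.translate (x : G) (f : Dp S p) : Dp S p :=
  Dp.of (fun g => f (g * x⁻¹)) <| by
    have h : (fun g => f (g * x⁻¹)) = diff x f + (f : G → ℂ) := by
      ext g; simp [diff]
    rw [h]
    exact add_mem (diff_pSummable f x).mem_dirichlet f.mem

/-- A translation invariant linear functional on `D_p(G)/ℂ`. -/
def IsTILF (T : DpModC S p →ₗ[ℂ] ℂ) : Prop :=
  ∀ (x : G) (f : Dp S p), T (f.translate x).toModC = T f.toModC

end Spaces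

end PHarmonic

end

/-! Let N = `nullSpace S p` be the closure of the finitely supported functions. Since ℓ^p lies
between these functions and N, and the constants are finite-dimensional, the closure of ℓ^p + ℂ is N
+ ℂ. So item 1 says N + ℂ = D_p, and every other item is compared with this equation. Truncation
shows that it suffices to decompose bounded functions (`sup_eq_top_of_bounded`).

Boundary: if f = b + c with b in N, every boundary character sends f to c. Conversely, the elements
of N tend to zero along a filter on G (`nullFilter`), and a bounded function tending to zero along
it is in N (`mem_nullSpace_of_tendsto_nullFilter`). Limits along finer ultrafilters are boundary
characters, so if there is at most one of these, each bounded f has a limit c along the filter, and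
f - c is in N.

Harmonic functions: f is p-harmonic exactly when it minimises the energy among its finitely
supported perturbations. If f = b + c, then f - b has energy zero, hence so does f. Conversely,
uniform convexity of ℓ^p makes minimising sequences converge, and every bounded f is a bounded
p-harmonic function plus an element of N (`exists_royden_decomposition`).

Functionals: a TILF takes one value on all point masses; a sum of n of them has norm O(n^(1/p)), so
continuity and p > 1 force the value zero, and T vanishes on N. Conversely, translation moves f by
an element of ℓ^p, so every functional vanishing on N + ℂ is invariant, and Hahn–Banach supplies a
nonzero one unless N + ℂ = D_p.

Nonamenable G: the isoperimetric inequality (`exists_pSum_isoperimetric`) makes ℓ^p closed in D_p,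
so N = ℓ^p, and it gives an averaging operator of norm less than 1. Inverting 1 minus this operator
writes each element of ℓ^p as a sum of differences of translates, which every TILF kills, continuous
or not. -/

noncomputable section

namespace PHarmonic

open Filter Topology

/-! ### Sums of p-th powers and a dominated convergence theorem. -/

section Sums

variable {ι : Type*} {p : ℝ}

/-- The sum `∑ |u i| ^ p`. -/
def pSum (p : ℝ) (u : ι → ℂ) : ℝ := ∑' i, ‖u i‖ ^ p

theorem pSum_nonneg (u : ι → ℂ) : 0 ≤ pSum p u := tsum_nonneg fun _ => by positivity

theorem add_rpow_le_two_rpow_mul {x y p : ℝ} (hx : 0 ≤ x) (hy : 0 ≤ y) (hp : 0 ≤ p) :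
    (x + y) ^ p ≤ 2 ^ p * (x ^ p + y ^ p) := by
  have key : ∀ x y : ℝ, 0 ≤ x → x ≤ y → (x + y) ^ p ≤ 2 ^ p * (x ^ p + y ^ p) := by
    intro x y hx hxy
    calc (x + y) ^ p ≤ (2 * y) ^ p :=
          Real.rpow_le_rpow (by linarith) (by linarith) hp
      _ = 2 ^ p * y ^ p := Real.mul_rpow (by norm_num) (hx.trans hxy)
      _ ≤ 2 ^ p * (x ^ p + y ^ p) := by
        have : 0 ≤ x ^ p := Real.rpow_nonneg hx p
        gcongr; linarith
  rcases le_total x y with h | h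
  · exact key x y hx h
  · rw [add_comm x, add_comm (x ^ p)]; exact key y x hy h

theorem PSummable.of_norm_le (hp : 0 ≤ p) {u v : ι → ℂ} (hv : PSummable p v) {C : ℝ} (hC : 0 ≤ C)
    (h : ∀ i, ‖u i‖ ≤ C * ‖v i‖) : PSummable p u := by
  refine Summable.of_nonneg_of_le (fun i => by positivity) (fun i => ?_) (hv.mul_left (C ^ p))
  rw [← Real.mul_rpow hC (norm_nonneg _)]
  exact Real.rpow_le_rpow (norm_nonneg _) (h i) hp

theorem pSum_le_of_norm_le (hp : 0 ≤ p) {u v : ι → ℂ} (hv : PSummable p v) {C : ℝ} (hC : 0 ≤ C)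
    (h : ∀ i, ‖u i‖ ≤ C * ‖v i‖) : pSum p u ≤ C ^ p * pSum p v := by
  rw [pSum, pSum, ← tsum_mul_left]
  refine Summable.tsum_le_tsum (fun i => ?_) (hv.of_norm_le hp hC h) (hv.mul_left (C ^ p))
  rw [← Real.mul_rpow hC (norm_nonneg _)]
  exact Real.rpow_le_rpow (norm_nonneg _) (h i) hp

theorem norm_rpow_le_pSum {u : ι → ℂ} (hu : PSummable p u) (i : ι) : ‖u i‖ ^ p ≤ pSum p u :=
  hu.le_tsum i fun _ _ => by positivity

variable [hp : Fact (1 ≤ p)]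

theorem pSum_add_le {u v : ι → ℂ} (hu : PSummable p u) (hv : PSummable p v) :
    pSum p (u + v) ≤ 2 ^ p * (pSum p u + pSum p v) := by
  have h0 : 0 ≤ p := zero_le_one.trans hp.out
  rw [pSum, pSum, pSum, ← Summable.tsum_add hu hv, ← tsum_mul_left]
  refine Summable.tsum_le_tsum (fun i => ?_) (hu.add hv) ((Summable.add hu hv).mul_left _)
  exact (Real.rpow_le_rpow (norm_nonneg _) (norm_add_le _ _) h0).trans
    (add_rpow_le_two_rpow_mul (norm_nonneg _) (norm_nonneg _) h0)

/-- A generalised dominated convergence theorem for `p`-th power sums. -/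
theorem tendsto_pSum_zero {α : Type*} {l : Filter α} {w v : α → ι → ℂ} {a : ι → ℂ}
    (ha : PSummable p a) (hv : ∀ n, PSummable p (v n))
    (hvl : Tendsto (fun n => pSum p (v n)) l (𝓝 0))
    (hle : ∀ n i, ‖w n i‖ ≤ ‖v n i‖ + ‖a i‖)
    (hw : ∀ i, Tendsto (fun n => w n i) l (𝓝 0)) :
    Tendsto (fun n => pSum p (w n)) l (𝓝 0) := by
  have h0 : 0 < p := lt_of_lt_of_le one_pos hp.out
  -- The excess of `w` over `v` is dominated by the fixed `a`, so ordinary dominated convergence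
  -- applies to it; the rest of `w` is controlled by `v`.
  let z : α → ι → ℝ := fun n i => max (‖w n i‖ - ‖v n i‖) 0
  have hz0 : ∀ n i, 0 ≤ z n i := fun n i => le_max_right _ _
  have hza : ∀ n i, z n i ≤ ‖a i‖ := fun n i =>
    max_le (by have := hle n i; linarith) (norm_nonneg _)
  have hzw : ∀ n i, z n i ≤ ‖w n i‖ := fun n i =>
    max_le (by have := norm_nonneg (v n i); linarith) (norm_nonneg _)
  have hwz : ∀ n i, ‖w n i‖ ≤ ‖v n i‖ + z n i := fun n i => by
    have := le_max_left (‖w n i‖ - ‖v n i‖) 0; simp only [z]; linarith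
  have hzs : ∀ n, Summable fun i => z n i ^ p := fun n =>
    Summable.of_nonneg_of_le (fun i => Real.rpow_nonneg (hz0 n i) _)
      (fun i => Real.rpow_le_rpow (hz0 n i) (hza n i) h0.le) ha
  have hzl : Tendsto (fun n => ∑' i, z n i ^ p) l (𝓝 0) := by
    have := tendsto_tsum_of_dominated_convergence (𝓕 := l) (f := fun n i => z n i ^ p)
      (g := fun _ => (0 : ℝ)) (bound := fun i => ‖a i‖ ^ p) ha (fun i => ?_)
      (Eventually.of_forall fun n i => ?_)
    · simpa using this
    · have h1 : Tendsto (fun n => z n i) l (𝓝 0) :=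
        squeeze_zero (fun n => hz0 n i) (fun n => hzw n i) (tendsto_zero_iff_norm_tendsto_zero.1 (hw i))
      have := h1.rpow_const (p := p) (Or.inr h0.le)
      rwa [Real.zero_rpow h0.ne'] at this
    · rw [Real.norm_of_nonneg (Real.rpow_nonneg (hz0 n i) _)]
      exact Real.rpow_le_rpow (hz0 n i) (hza n i) h0.le
  have hlim : Tendsto (fun n => 2 ^ p * (pSum p (v n) + ∑' i, z n i ^ p)) l (𝓝 0) := by
    simpa using (hvl.add hzl).const_mul (2 ^ p)
  refine squeeze_zero (fun n => pSum_nonneg _) (fun n => ?_) hlim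
  have hle' : ∀ i, ‖w n i‖ ^ p ≤ 2 ^ p * (‖v n i‖ ^ p + z n i ^ p) := fun i =>
    (Real.rpow_le_rpow (norm_nonneg _) (hwz n i) h0.le).trans
      (add_rpow_le_two_rpow_mul (norm_nonneg _) (hz0 n i) h0.le)
  have hs := (Summable.add (hv n) (hzs n)).mul_left (2 ^ p)
  rw [pSum, pSum, ← Summable.tsum_add (hv n) (hzs n), ← tsum_mul_left]
  exact Summable.tsum_le_tsum hle'
    (Summable.of_nonneg_of_le (fun i => by positivity) hle' hs) hs

end Sums

/-! ### The gradient and convergence in D_p. -/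

section Gradient

variable {G : Type*} [Group G] {S : SymmGenSet G} {p : ℝ} [hp : Fact (1 ≤ p)]

/-- All differences `f (g s⁻¹) - f g`, for `s ∈ S` and `g ∈ G`, as one family. -/
def grad (S : SymmGenSet G) (f : G → ℂ) : S.carrier × G → ℂ := fun i => diff i.1.1 f i.2

theorem grad_apply (f : G → ℂ) (i : S.carrier × G) :
    grad S f i = f (i.2 * (i.1.1)⁻¹) - f i.2 := rfl

theorem mem_dirichletSubmodule_iff {f : G → ℂ} :
    f ∈ dirichletSubmodule S p ↔ PSummable p (grad S f) := by
  rw [PSummable, summable_prod_of_nonneg (fun i => by dsimp; positivity)]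
  constructor
  · intro h
    exact ⟨fun s => h s.1 s.2, Summable.of_finite⟩
  · intro h s hs
    exact h.1 ⟨s, hs⟩

theorem Dp.pSummable_grad (f : Dp S p) : PSummable p (grad S f) :=
  mem_dirichletSubmodule_iff.1 f.mem

theorem energy_eq_pSum (f : Dp S p) : energy f = pSum p (grad S f) := by
  rw [pSum, Summable.tsum_prod f.pSummable_grad, tsum_fintype, energy, ← Finset.sum_coe_sort]
  rfl

theorem Dp.sub_apply (f h : Dp S p) (g : G) : (f - h) g = f g - h g := rfl

theorem grad_add (f h : Dp S p) : grad S (f + h : Dp S p) = grad S f + grad S h := by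
  ext i; simp only [grad_apply, Pi.add_apply, Dp.add_apply]; ring

theorem grad_sub (f h : Dp S p) : grad S (f - h : Dp S p) = grad S f - grad S h := by
  ext i; simp only [grad_apply, Pi.sub_apply, Dp.sub_apply]; ring

theorem grad_smul (c : ℂ) (f : Dp S p) : grad S (c • f : Dp S p) = c • grad S f := by
  ext i; simp only [grad_apply, Pi.smul_apply, Dp.smul_apply, smul_eq_mul]; ring

theorem Dp.norm_rpow (f : Dp S p) : ‖f‖ ^ p = energy f + ‖f 1‖ ^ p := by
  have h0 : 0 < p := lt_of_lt_of_le one_pos hp.out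
  have := energy_nonneg f
  rw [Dp.norm_def, ← Real.rpow_mul (by positivity), one_div_mul_cancel h0.ne', Real.rpow_one]

theorem energy_le_norm_rpow (f : Dp S p) : energy f ≤ ‖f‖ ^ p := by
  rw [Dp.norm_rpow]; exact le_add_of_nonneg_right (by positivity)

theorem tendsto_rpow_zero_iff {α : Type*} {l : Filter α} {u : α → ℝ} (hu : ∀ n, 0 ≤ u n)
    {p : ℝ} (h0 : 0 < p) : Tendsto (fun n => u n ^ p) l (𝓝 0) ↔ Tendsto u l (𝓝 0) := by
  constructor
  · intro h
    have := h.rpow_const (p := 1 / p) (Or.inr (by positivity))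
    rw [Real.zero_rpow (by positivity)] at this
    refine this.congr fun n => ?_
    rw [← Real.rpow_mul (hu n), mul_one_div_cancel h0.ne', Real.rpow_one]
  · intro h
    have := h.rpow_const (p := p) (Or.inr h0.le)
    rwa [Real.zero_rpow h0.ne'] at this

theorem Dp.tendsto_zero_iff {α : Type*} {l : Filter α} {u : α → Dp S p} :
    Tendsto u l (𝓝 0) ↔
      Tendsto (fun n => energy (u n)) l (𝓝 0) ∧ Tendsto (fun n => u n 1) l (𝓝 0) := by
  have h0 : 0 < p := lt_of_lt_of_le one_pos hp.out
  rw [tendsto_zero_iff_norm_tendsto_zero, ← tendsto_rpow_zero_iff (fun n => norm_nonneg _) h0,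
    tendsto_zero_iff_norm_tendsto_zero (f := fun n => u n 1),
    ← tendsto_rpow_zero_iff (fun n => norm_nonneg (u n 1)) h0]
  simp only [Dp.norm_rpow]
  constructor
  · intro h
    exact ⟨squeeze_zero (fun n => energy_nonneg _)
        (fun n => le_add_of_nonneg_right (by positivity)) h,
      squeeze_zero (fun n => by positivity)
        (fun n => le_add_of_nonneg_left (energy_nonneg _)) h⟩
  · rintro ⟨h1, h2⟩
    simpa using h1.add h2

theorem Dp.tendsto_iff {α : Type*} {l : Filter α} {u : α → Dp S p} {f : Dp S p} :
    Tendsto u l (𝓝 f) ↔ Tendsto (fun n => energy (u n - f)) l (𝓝 0) ∧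
      Tendsto (fun n => u n 1) l (𝓝 (f 1)) := by
  rw [← tendsto_sub_nhds_zero_iff, Dp.tendsto_zero_iff]
  simp only [Dp.sub_apply, tendsto_sub_nhds_zero_iff]

theorem tendsto_grad_of_tendsto_energy {α : Type*} {l : Filter α} {u : α → Dp S p}
    (h : Tendsto (fun n => energy (u n)) l (𝓝 0)) (i : S.carrier × G) :
    Tendsto (fun n => grad S (u n) i) l (𝓝 0) := by
  have h0 : 0 < p := lt_of_lt_of_le one_pos hp.out
  rw [tendsto_zero_iff_norm_tendsto_zero, ← tendsto_rpow_zero_iff (fun n => norm_nonneg _) h0]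
  refine squeeze_zero (fun n => by positivity) (fun n => ?_) h
  rw [energy_eq_pSum]
  exact norm_rpow_le_pSum (u n).pSummable_grad i

/-- The norm sees only the value at the identity and the differences along edges; convergence
spreads from the identity because `S` generates. -/
theorem Dp.tendsto_apply_zero {α : Type*} {l : Filter α} {u : α → Dp S p}
    (h : Tendsto u l (𝓝 0)) (g : G) : Tendsto (fun n => u n g) l (𝓝 0) := by
  obtain ⟨hE, h1⟩ := Dp.tendsto_zero_iff.1 h
  have step : ∀ s ∈ S.carrier, ∀ g, Tendsto (fun n => u n g) l (𝓝 0) ↔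
      Tendsto (fun n => u n (g * s⁻¹)) l (𝓝 0) := by
    intro s hs g
    have h2 := tendsto_grad_of_tendsto_energy hE (⟨s, hs⟩, g)
    constructor
    · intro h3
      simpa [grad_apply] using h2.add h3
    · intro h3
      simpa [grad_apply] using h3.sub h2
  have : ∀ x ∈ Subgroup.closure (S.carrier : Set G), ∀ g,
      Tendsto (fun n => u n g) l (𝓝 0) ↔ Tendsto (fun n => u n (g * x)) l (𝓝 0) := by
    intro x hx
    induction hx using Subgroup.closure_induction with
    | mem x hx => intro g; have := step x⁻¹ (S.inv_mem x hx) g; rwa [inv_inv] at this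
    | one => simp
    | mul x y _ _ hx hy => intro g; rw [hx g, hy (g * x), mul_assoc]
    | inv x _ hx => intro g; rw [hx (g * x⁻¹)]; simp
  simpa using (this g (by rw [S.closure_eq_top]; trivial) 1).1 h1

theorem Dp.tendsto_apply {α : Type*} {l : Filter α} {u : α → Dp S p} {f : Dp S p}
    (h : Tendsto u l (𝓝 f)) (g : G) : Tendsto (fun n => u n g) l (𝓝 (f g)) := by
  rw [← tendsto_sub_nhds_zero_iff] at h ⊢
  exact Dp.tendsto_apply_zero h g

theorem energy_eq_norm_sub (f : Dp S p) : energy f = ‖f‖ ^ p - ‖f 1‖ ^ p := by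
  rw [Dp.norm_rpow]; ring

theorem Dp.tendsto_energy {α : Type*} {l : Filter α} {u : α → Dp S p} {f : Dp S p}
    (h : Tendsto u l (𝓝 f)) : Tendsto (fun n => energy (u n)) l (𝓝 (energy f)) := by
  have h0 : 0 ≤ p := zero_le_one.trans hp.out
  simp only [energy_eq_norm_sub]
  exact (h.norm.rpow_const (Or.inr h0)).sub
    (((Dp.tendsto_apply h 1).norm).rpow_const (Or.inr h0))

theorem energy_of_mem_constants {f : Dp S p} (hf : f ∈ constants S p) : energy f = 0 := by
  have h0 : 0 < p := lt_of_lt_of_le one_pos hp.out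
  obtain ⟨c, hc⟩ := hf
  simp [energy, diff, hc, Real.zero_rpow h0.ne']

end Gradient

/-! ### Composition with Lipschitz functions, and truncation. -/

section Composition

variable {G : Type*} [Group G] {S : SymmGenSet G} {p : ℝ} [hp : Fact (1 ≤ p)]

/-- Composition of an element of `D_p(G)` with a Lipschitz function. -/
def Dp.lipComp (φ : ℂ → ℂ) {K : NNReal} (hφ : LipschitzWith K φ) (f : Dp S p) : Dp S p :=
  Dp.of (fun g => φ (f g)) <| by
    rw [mem_dirichletSubmodule_iff]
    exact f.pSummable_grad.of_norm_le (zero_le_one.trans hp.out) K.2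
      fun i => hφ.norm_sub_le _ _

theorem Dp.lipComp_apply (φ : ℂ → ℂ) {K : NNReal} (hφ : LipschitzWith K φ) (f : Dp S p) (g : G) :
    f.lipComp φ hφ g = φ (f g) := rfl

theorem norm_grad_lipComp_le (φ : ℂ → ℂ) {K : NNReal} (hφ : LipschitzWith K φ) (f : Dp S p)
    (i : S.carrier × G) : ‖grad S (f.lipComp φ hφ) i‖ ≤ K * ‖grad S f i‖ :=
  hφ.norm_sub_le _ _

theorem energy_lipComp_le (φ : ℂ → ℂ) (hφ : LipschitzWith 1 φ) (f : Dp S p) :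
    energy (f.lipComp φ hφ) ≤ energy f := by
  rw [energy_eq_pSum, energy_eq_pSum]
  simpa using pSum_le_of_norm_le (zero_le_one.trans hp.out) f.pSummable_grad zero_le_one
    (norm_grad_lipComp_le φ hφ f)

/-- A Lipschitz bound on `φ` does not bound the gradient of `φ ∘ u - φ ∘ f` by that of `u - f`.
Convergence comes instead from pointwise convergence with domination: K|∂u| + K|∂f| ≤ K|∂(u - f)| +
2K|∂f|. -/
theorem Dp.tendsto_lipComp (φ : ℂ → ℂ) {K : NNReal} (hφ : LipschitzWith K φ)
    {α : Type*} {l : Filter α} {u : α → Dp S p} {f : Dp S p} (h : Tendsto u l (𝓝 f)) :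
    Tendsto (fun n => (u n).lipComp φ hφ) l (𝓝 (f.lipComp φ hφ)) := by
  have h0 : 0 < p := lt_of_lt_of_le one_pos hp.out
  have hpt : ∀ g, Tendsto (fun n => φ (u n g)) l (𝓝 (φ (f g))) := fun g =>
    (hφ.continuous.tendsto _).comp (Dp.tendsto_apply h g)
  refine Dp.tendsto_iff.2 ⟨?_, hpt 1⟩
  simp only [energy_eq_pSum]
  refine tendsto_pSum_zero (v := fun n => (K : ℂ) • grad S (u n - f : Dp S p))
    (a := (2 * K : ℂ) • grad S f) (f.pSummable_grad.const_smul _)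
    (fun n => (u n - f).pSummable_grad.const_smul _) ?_ ?_ ?_
  · have h1 := (Dp.tendsto_iff.1 h).1.const_mul ((K : ℝ) ^ p)
    rw [mul_zero] at h1
    refine h1.congr fun n => ?_
    rw [energy_eq_pSum, pSum, pSum, ← tsum_mul_left]
    congr 1; ext i
    simp [Real.mul_rpow]
  · intro n i
    have h1 : ‖grad S (u n) i‖ ≤ ‖grad S (u n - f : Dp S p) i‖ + ‖grad S f i‖ := by
      rw [grad_sub, Pi.sub_apply]
      simpa using norm_add_le (grad S (u n) i - grad S f i) (grad S f i)
    have h2 := norm_grad_lipComp_le φ hφ (u n) i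
    have h3 := norm_grad_lipComp_le φ hφ f i
    rw [grad_sub, Pi.sub_apply]
    refine (norm_sub_le _ _).trans ((add_le_add h2 h3).trans ?_)
    have h4 := mul_le_mul_of_nonneg_left h1 K.2
    simp only [Pi.smul_apply, norm_smul, norm_mul, Complex.norm_ofNat,
      Complex.norm_real, Real.norm_eq_abs, NNReal.abs_eq]
    change (K : ℝ) * _ ≤ (K : ℝ) * _ at h4
    linarith
  · intro i
    have h1 := ((hpt (i.2 * (i.1.1)⁻¹)).sub (hpt i.2)).sub_const
      (φ (f (i.2 * (i.1.1)⁻¹)) - φ (f i.2))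
    rw [sub_self] at h1
    refine h1.congr fun n => ?_
    rw [grad_sub]
    rfl

/-- Truncation of the real and imaginary parts to `[-M, M]`. -/
def clamp (M : ℝ) (z : ℂ) : ℂ := ⟨max (min z.re M) (-M), max (min z.im M) (-M)⟩

theorem lipschitzWith_clamp (M : ℝ) : LipschitzWith 1 (clamp M) := by
  have key : ∀ x y : ℝ, |max (min x M) (-M) - max (min y M) (-M)| ≤ |x - y| := fun x y =>
    (abs_max_sub_max_le_abs _ _ _).trans (abs_inf_sub_inf_le_abs _ _ _)
  refine LipschitzWith.of_dist_le_mul fun z w => ?_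
  rw [NNReal.coe_one, one_mul, dist_eq_norm, dist_eq_norm, Complex.norm_eq_sqrt_sq_add_sq,
    Complex.norm_eq_sqrt_sq_add_sq]
  exact Real.sqrt_le_sqrt (add_le_add (sq_le_sq.2 (key _ _)) (sq_le_sq.2 (key _ _)))

theorem norm_clamp_le {M : ℝ} (hM : 0 ≤ M) (z : ℂ) : ‖clamp M z‖ ≤ 2 * M := by
  have key : ∀ x : ℝ, |max (min x M) (-M)| ≤ M := fun x =>
    abs_le.2 ⟨le_max_right _ _, max_le (min_le_right _ _) (by linarith)⟩
  refine (Complex.norm_le_abs_re_add_abs_im _).trans ?_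
  have h1 := key z.re
  have h2 := key z.im
  simp only [clamp]
  linarith

theorem clamp_eq_self {M : ℝ} {z : ℂ} (h : ‖z‖ ≤ M) : clamp M z = z := by
  have h1 := abs_le.1 ((Complex.abs_re_le_norm z).trans h)
  have h2 := abs_le.1 ((Complex.abs_im_le_norm z).trans h)
  apply Complex.ext <;> simp [clamp, *]

theorem clamp_zero_right {M : ℝ} (hM : 0 ≤ M) : clamp M 0 = 0 := clamp_eq_self (by simpa)

theorem Dp.tendsto_clamp_atTop (f : Dp S p) :
    Tendsto (fun n : ℕ => f.lipComp (clamp n) (lipschitzWith_clamp n)) atTop (𝓝 f) := by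
  have hpt : ∀ g, ∀ᶠ n : ℕ in atTop, clamp n (f g) = f g := fun g =>
    (eventually_ge_atTop ⌈‖f g‖⌉₊).mono fun n hn => clamp_eq_self (Nat.ceil_le.1 hn)
  refine Dp.tendsto_iff.2 ⟨?_, tendsto_nhds_of_eventually_eq (hpt 1)⟩
  simp only [energy_eq_pSum]
  refine tendsto_pSum_zero (v := fun _ => 0) (a := (2 : ℂ) • grad S f)
    (f.pSummable_grad.const_smul _) (fun _ => PSummable.zero) ?_ ?_ ?_
  · have h0 : 0 < p := lt_of_lt_of_le one_pos hp.out
    simp [pSum, Real.zero_rpow h0.ne']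
  · intro n i
    have h2 := norm_grad_lipComp_le (clamp n) (lipschitzWith_clamp n) f i
    rw [grad_sub, Pi.sub_apply]
    refine (norm_sub_le _ _).trans ((add_le_add_left h2 _).trans ?_)
    simp only [Pi.smul_apply, norm_smul, Pi.zero_apply, norm_zero, Complex.norm_ofNat,
      NNReal.coe_one]
    linarith
  · intro i
    refine tendsto_nhds_of_eventually_eq ?_
    filter_upwards [hpt i.2, hpt (i.2 * (i.1.1)⁻¹)] with n h1 h2
    simp [grad_apply, Dp.sub_apply, Dp.lipComp_apply, h1, h2]

end Composition

/-! ### The closure of the finitely supported functions. -/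

section Closure

variable {G : Type*} [Group G] (S : SymmGenSet G) (p : ℝ) [hp : Fact (1 ≤ p)]

/-- The subspace of finitely supported functions. -/
def finSuppSubmodule : Submodule ℂ (Dp S p) where
  carrier := finSupp S p
  add_mem' {a b} ha hb := (Set.Finite.union ha hb).subset (Function.support_add (a : G → ℂ) b)
  zero_mem' := by
    have : Function.support (0 : Dp S p) = ∅ := Function.support_eq_empty_iff.2 rfl
    change Set.Finite _
    rw [this]; exact Set.finite_empty
  smul_mem' c f hf := Set.Finite.subset hf (Function.support_const_smul_subset c (f : G → ℂ))

/-- The closure of the finitely supported functions, as a subspace. -/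
def nullSpace : Submodule ℂ (Dp S p) := (finSuppSubmodule S p).topologicalClosure

variable {S p}

theorem isClosed_nullSpace : IsClosed (nullSpace S p : Set (Dp S p)) := isClosed_closure

theorem finSupp_subset_nullSpace : finSupp S p ⊆ nullSpace S p := subset_closure

theorem mem_nullSpace_of_tendsto {α : Type*} {l : Filter α} [l.NeBot] {u : α → Dp S p} {f : Dp S p}
    (h : Tendsto u l (𝓝 f)) (hu : ∀ n, u n ∈ nullSpace S p) : f ∈ nullSpace S p :=
  isClosed_nullSpace.mem_of_tendsto h (Eventually.of_forall hu)

theorem exists_seq_of_mem_nullSpace {f : Dp S p} (hf : f ∈ nullSpace S p) :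
    ∃ u : ℕ → Dp S p, (∀ n, u n ∈ finSupp S p) ∧ Tendsto u atTop (𝓝 f) :=
  mem_closure_iff_seq_limit.1 hf

theorem lipComp_mem_finSupp (φ : ℂ → ℂ) {K : NNReal} (hφ : LipschitzWith K φ) (h0 : φ 0 = 0)
    {f : Dp S p} (hf : f ∈ finSupp S p) : f.lipComp φ hφ ∈ finSupp S p :=
  Set.Finite.subset hf fun g hg h => hg (by rw [Dp.lipComp_apply, h, h0])

theorem lipComp_mem_nullSpace (φ : ℂ → ℂ) {K : NNReal} (hφ : LipschitzWith K φ) (h0 : φ 0 = 0)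
    {f : Dp S p} (hf : f ∈ nullSpace S p) : f.lipComp φ hφ ∈ nullSpace S p := by
  obtain ⟨u, hu, hlim⟩ := exists_seq_of_mem_nullSpace hf
  exact mem_nullSpace_of_tendsto (Dp.tendsto_lipComp φ hφ hlim) fun n =>
    finSupp_subset_nullSpace (lipComp_mem_finSupp φ hφ h0 (hu n))

/-- The product of a bounded function in `nullSpace` with a bounded function in `D_p(G)` is in
`nullSpace`. -/
theorem mul_mem_nullSpace {b f k : Dp S p} (hb : b ∈ nullSpace S p) (hbb : IsBdd b) (hf : IsBdd f)
    (hk : ∀ g, k g = b g * f g) : k ∈ nullSpace S p := by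
  obtain ⟨M, hM⟩ := hbb
  obtain ⟨C, hC⟩ := hf
  have hM0 : 0 ≤ M := (norm_nonneg _).trans (hM 1)
  have hC0 : 0 ≤ C := (norm_nonneg _).trans (hC 1)
  obtain ⟨u', hu', hlim'⟩ := exists_seq_of_mem_nullSpace hb
  -- Truncation at the bound of `b` makes the approximants uniformly bounded and does not change
  -- their limit `b`.
  let u : ℕ → Dp S p := fun n => (u' n).lipComp (clamp M) (lipschitzWith_clamp M)
  have hu : ∀ n, u n ∈ finSupp S p := fun n =>
    lipComp_mem_finSupp _ _ (clamp_zero_right hM0) (hu' n)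
  have huM : ∀ n g, ‖u n g‖ ≤ 2 * M := fun n g => norm_clamp_le hM0 _
  have hlim : Tendsto u atTop (𝓝 b) := by
    have h1 := Dp.tendsto_lipComp (clamp M) (lipschitzWith_clamp M) hlim'
    have h2 : b.lipComp (clamp M) (lipschitzWith_clamp M) = b :=
      Dp.ext fun g => clamp_eq_self (hM g)
    rwa [h2] at h1
  have hfin : ∀ n, (Function.support fun g => u n g * f g).Finite := fun n =>
    Set.Finite.subset (hu n) fun g hg h => hg (by simp [h])
  let w : ℕ → Dp S p := fun n => Dp.of (fun g => u n g * f g)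
    (pSummable_of_finite_support (hfin n)).mem_dirichlet
  refine mem_nullSpace_of_tendsto (l := atTop) (u := w) ?_ fun n =>
    finSupp_subset_nullSpace (hfin n)
  have hpt : ∀ g, Tendsto (fun n => u n g - b g) atTop (𝓝 0) := fun g =>
    tendsto_sub_nhds_zero_iff.2 (Dp.tendsto_apply hlim g)
  have hwk : ∀ n g, (w n - k) g = (u n g - b g) * f g := fun n g => by
    rw [Dp.sub_apply, hk]; change u n g * f g - _ = _; ring
  have hpt' : ∀ g, Tendsto (fun n => (w n - k) g) atTop (𝓝 0) := fun g => by
    simp only [hwk]; simpa using (hpt g).mul_const (f g)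
  rw [← tendsto_sub_nhds_zero_iff, Dp.tendsto_zero_iff]
  refine ⟨?_, hpt' 1⟩
  simp only [energy_eq_pSum]
  -- By the Leibniz rule the gradient is f·∂(u n - b) + (u n - b)·∂f. The first term has small
  -- energy; the second is dominated by 3M|∂f|, where 3M = 2M + M bounds u n - b.
  refine tendsto_pSum_zero (v := fun n => (C : ℂ) • grad S (u n - b : Dp S p))
    (a := (3 * M : ℂ) • grad S f) (f.pSummable_grad.const_smul _)
    (fun n => (u n - b).pSummable_grad.const_smul _) ?_ ?_ ?_
  · have h1 := (Dp.tendsto_iff.1 hlim).1.const_mul ((C : ℝ) ^ p)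
    rw [mul_zero] at h1
    refine h1.congr fun n => ?_
    rw [energy_eq_pSum, pSum, pSum, ← tsum_mul_left]
    congr 1; ext i
    simp [Real.mul_rpow, abs_of_nonneg hC0, hC0]
  · intro n i
    have h1 : grad S (w n - k : Dp S p) i =
        f (i.2 * (i.1.1)⁻¹) * grad S (u n - b : Dp S p) i + (u n i.2 - b i.2) * grad S f i := by
      simp only [grad_apply, hwk, Dp.sub_apply]; ring
    rw [h1]
    refine (norm_add_le _ _).trans (add_le_add ?_ ?_)
    · simp only [norm_mul, Pi.smul_apply, norm_smul, Complex.norm_real, Real.norm_of_nonneg hC0]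
      exact mul_le_mul_of_nonneg_right (hC _) (norm_nonneg _)
    · simp only [norm_mul, Pi.smul_apply, norm_smul, Complex.norm_real, Real.norm_of_nonneg hM0,
        Complex.norm_ofNat]
      refine mul_le_mul_of_nonneg_right ((norm_sub_le _ _).trans ?_) (norm_nonneg _)
      have := huM n i.2
      have := hM i.2
      linarith
  · intro i
    simpa [grad_apply] using (hpt' (i.2 * (i.1.1)⁻¹)).sub (hpt' i.2)

/-- The restrictions of `f` to growing finite sets converge to `f`: the gradient of the error is
dominated by |f(gs⁻¹)| + |f(g)|, which is p-summable. -/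
theorem ellp_le_nullSpace : ellp S p ≤ nullSpace S p := by
  intro f hf
  have h0 : 0 < p := lt_of_lt_of_le one_pos hp.out
  classical
  have hfin : ∀ A : Finset G, (Function.support fun g => if g ∈ A then f g else 0).Finite :=
    fun A => Set.Finite.subset A.finite_toSet fun g hg => by
      by_contra h; exact hg (if_neg h)
  let w : Finset G → Dp S p := fun A => Dp.of (fun g => if g ∈ A then f g else 0)
    (pSummable_of_finite_support (hfin A)).mem_dirichlet
  refine mem_nullSpace_of_tendsto (l := atTop) (u := w) ?_ fun A =>
    finSupp_subset_nullSpace (hfin A)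
  have hpt : ∀ g, ∀ᶠ A in atTop, (w A - f) g = 0 := fun g =>
    (eventually_ge_atTop {g}).mono fun A hA => by
      have : g ∈ A := hA (Finset.mem_singleton_self g)
      rw [Dp.sub_apply]; change (if g ∈ A then f g else 0) - f g = 0
      simp [this]
  have hle : ∀ A g, ‖(w A - f) g‖ ≤ ‖f g‖ := fun A g => by
    rw [Dp.sub_apply]; change ‖(if g ∈ A then f g else 0) - f g‖ ≤ _
    split_ifs <;> simp
  rw [← tendsto_sub_nhds_zero_iff, Dp.tendsto_zero_iff]
  refine ⟨?_, tendsto_nhds_of_eventually_eq (hpt 1)⟩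
  simp only [energy_eq_pSum]
  have hsum : PSummable p fun i : S.carrier × G => (‖f (i.2 * (i.1.1)⁻¹)‖ : ℂ) + ‖f i.2‖ := by
    rw [PSummable, summable_prod_of_nonneg (fun i => by dsimp; positivity)]
    refine ⟨fun s => ?_, Summable.of_finite⟩
    have hfn : PSummable p fun g => (‖f g‖ : ℂ) := by
      simpa [PSummable] using (show Summable fun g => ‖f g‖ ^ p from hf)
    exact (hfn.translate (s.1)⁻¹).add hfn
  refine tendsto_pSum_zero (v := fun _ => 0) hsum (fun _ => PSummable.zero) ?_ ?_ ?_
  · simp [pSum, Real.zero_rpow h0.ne']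
  · intro A i
    rw [grad_apply, ← Complex.ofReal_add, Complex.norm_real, Real.norm_of_nonneg (by positivity)]
    simpa using (norm_sub_le _ _).trans (add_le_add (hle A _) (hle A _))
  · intro i
    refine tendsto_nhds_of_eventually_eq ?_
    filter_upwards [hpt i.2, hpt (i.2 * (i.1.1)⁻¹)] with A h1 h2
    simp [grad_apply, h1, h2]

theorem finSupp_subset_ellp : finSupp S p ⊆ ellp S p := fun _ hf => pSummable_of_finite_support hf

/-- This is what makes the sum of the closed subspace `nullSpace S p` and the constants closed. -/
instance : FiniteDimensional ℂ (constants S p) := by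
  have : constants S p ≤ Submodule.span ℂ {Dp.of (fun _ => 1) (const_mem_dirichlet 1)} := by
    rintro f ⟨c, hc⟩
    refine Submodule.mem_span_singleton.2 ⟨c, Dp.ext fun g => ?_⟩
    rw [Dp.smul_apply, Dp.of_apply, hc, mul_one]
  exact Submodule.finiteDimensional_of_le this

theorem closure_ellp_sup_constants :
    (ellp S p ⊔ constants S p).topologicalClosure = nullSpace S p ⊔ constants S p := by
  have hcl : IsClosed ((nullSpace S p ⊔ constants S p : Submodule ℂ (Dp S p)) : Set (Dp S p)) :=
    Submodule.isClosed_sup_finiteDimensional _ _ isClosed_nullSpace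
  apply le_antisymm
  · exact Submodule.topologicalClosure_minimal _ (sup_le_sup_right ellp_le_nullSpace _) hcl
  · refine sup_le ?_ (le_sup_right.trans (Submodule.le_topologicalClosure _))
    exact Submodule.topologicalClosure_mono
      (le_trans (show finSuppSubmodule S p ≤ ellp S p from finSupp_subset_ellp) le_sup_left)

/-- The reduced cohomology vanishes iff `D_p(G)` is spanned by `nullSpace` and the constants. -/
theorem subsingleton_reducedH1_iff :
    Subsingleton (reducedH1 S p) ↔ nullSpace S p ⊔ constants S p = ⊤ := by
  rw [Submodule.Quotient.subsingleton_iff, closure_ellp_sup_constants]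

/-- Since bounded functions are dense, it is enough to decompose these. -/
theorem sup_eq_top_of_bounded
    (h : ∀ f : Dp S p, IsBdd f → f ∈ nullSpace S p ⊔ constants S p) :
    nullSpace S p ⊔ constants S p = ⊤ := by
  have hcl : IsClosed ((nullSpace S p ⊔ constants S p : Submodule ℂ (Dp S p)) : Set (Dp S p)) :=
    Submodule.isClosed_sup_finiteDimensional _ _ isClosed_nullSpace
  refine eq_top_iff.2 fun f _ => hcl.mem_of_tendsto f.tendsto_clamp_atTop
    (Eventually.of_forall fun n => h _ ⟨2 * n, fun g => norm_clamp_le n.cast_nonneg _⟩)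

end Closure

/-! ### The p-harmonic boundary. -/

section Boundary

variable {G : Type*} [Group G] {S : SymmGenSet G} {p : ℝ} [hp : Fact (1 ≤ p)]

/-- If a bounded f is b + c with b in the null space and c constant, then b = f - c is bounded, so
every boundary character kills it and sends f to c. -/
theorem harmonicBoundary_subsingleton (h : nullSpace S p ⊔ constants S p = ⊤) :
    (harmonicBoundary S p).Subsingleton := by
  have key : ∀ f : BDp S p, ∃ c : ℂ, ∀ x ∈ harmonicBoundary S p, x f = c := by
    intro f
    obtain ⟨b, hb, k, ⟨c, hc⟩, hbk⟩ :=
      Submodule.mem_sup.1 (h ▸ Submodule.mem_top : BDp.toDp f ∈ nullSpace S p ⊔ constants S p)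
    refine ⟨c, fun x hx => ?_⟩
    have h1 : BDp.toDp (f - algebraMap ℂ (BDp S p) c) = b :=
      Dp.ext fun g => by
        have : f.1 g = b g + k g := congrArg (fun u : Dp S p => u g) hbk.symm
        change f.1 g - c = b g
        rw [this, hc]; ring
    have h2 := hx.2 (f - algebraMap ℂ (BDp S p) c) (h1 ▸ hb)
    rw [map_sub, AlgHom.commutes] at h2
    exact sub_eq_zero.1 h2
  intro x hx y hy
  refine AlgHom.ext fun f => ?_
  obtain ⟨c, hc⟩ := key f
  rw [hc x hx, hc y hy]

theorem lipschitzWith_ofReal_norm : LipschitzWith 1 fun z : ℂ => ((‖z‖ : ℝ) : ℂ) := by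
  refine LipschitzWith.of_dist_le_mul fun z w => ?_
  rw [NNReal.coe_one, one_mul, Complex.dist_eq, ← Complex.ofReal_sub, Complex.norm_real,
    dist_eq_norm]
  exact abs_norm_sub_norm_le z w

theorem lipschitzWith_min_norm_one : LipschitzWith 1 fun z : ℂ => ((min ‖z‖ 1 : ℝ) : ℂ) := by
  refine LipschitzWith.of_dist_le_mul fun z w => ?_
  rw [NNReal.coe_one, one_mul, Complex.dist_eq, ← Complex.ofReal_sub, Complex.norm_real,
    dist_eq_norm]
  exact (abs_inf_sub_inf_le_abs _ _ _).trans (abs_norm_sub_norm_le z w)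

variable (S p)

/-- The filter on `G` of the sets off which some element of `nullSpace` is bounded below.
The elements of `nullSpace` tend to zero along it. -/
def nullFilter : Filter G where
  sets := {A | ∃ b ∈ nullSpace S p, ∀ g ∉ A, 1 ≤ ‖b g‖}
  univ_sets := ⟨0, zero_mem _, fun g hg => (hg trivial).elim⟩
  sets_of_superset := by
    rintro A A' ⟨b, hb, h⟩ hA
    exact ⟨b, hb, fun g hg => h g fun hg' => hg (hA hg')⟩
  inter_sets := by
    rintro A A' ⟨b, hb, h⟩ ⟨b', hb', h'⟩
    -- Absolute values are taken before adding so that the two functions cannot cancel.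
    refine ⟨b.lipComp _ lipschitzWith_ofReal_norm + b'.lipComp _ lipschitzWith_ofReal_norm,
      add_mem (lipComp_mem_nullSpace _ _ (by simp) hb) (lipComp_mem_nullSpace _ _ (by simp) hb'),
      fun g hg => ?_⟩
    rw [Dp.add_apply, Dp.lipComp_apply, Dp.lipComp_apply, ← Complex.ofReal_add, Complex.norm_real,
      Real.norm_of_nonneg (by positivity)]
    by_cases hgA : g ∈ A
    · have := h' g fun hg' => hg ⟨hgA, hg'⟩
      have := norm_nonneg (b g)
      linarith
    · have := h g hgA
      have := norm_nonneg (b' g)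
      linarith

variable {S p}

theorem tendsto_nullFilter_of_mem_nullSpace {b : Dp S p} (hb : b ∈ nullSpace S p) :
    Tendsto b (nullFilter S p) (𝓝 0) := by
  rw [tendsto_zero_iff_norm_tendsto_zero, Metric.tendsto_nhds]
  intro ε hε
  refine ⟨((ε⁻¹ : ℝ) : ℂ) • b, Submodule.smul_mem _ _ hb, fun g hg => ?_⟩
  have hg' : ε ≤ ‖b g‖ := by
    by_contra h
    refine hg ?_
    change dist ‖b g‖ 0 < ε
    simpa using lt_of_not_ge h
  rw [Dp.smul_apply, norm_mul, Complex.norm_real, Real.norm_of_nonneg (by positivity)]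
  rw [← inv_mul_cancel₀ hε.ne']
  gcongr

/-- A bounded function in `D_p(G)` which tends to zero along `nullFilter` is in `nullSpace`. -/
theorem mem_nullSpace_of_tendsto_nullFilter {f : Dp S p} (hf : IsBdd f)
    (h : Tendsto f (nullFilter S p) (𝓝 0)) : f ∈ nullSpace S p := by
  have h0 : 0 < p := lt_of_lt_of_le one_pos hp.out
  -- The part of `f` of size at most 1/(n+1) tends to zero in D_p, its gradient being dominated by
  -- that of `f`. It remains to see that `f - c n`, which vanishes where `f` is small, is in the
  -- null space.
  let c : ℕ → Dp S p := fun n =>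
    f.lipComp (clamp (1 / ((n : ℝ) + 1))) (lipschitzWith_clamp _)
  have hcn : ∀ n g, ‖c n g‖ ≤ 2 * (1 / ((n : ℝ) + 1)) := fun n g => norm_clamp_le (by positivity) _
  have hc0 : ∀ g, Tendsto (fun n => c n g) atTop (𝓝 0) := fun g => by
    refine squeeze_zero_norm (fun n => hcn n g) ?_
    simpa using tendsto_one_div_add_atTop_nhds_zero_nat.const_mul (2 : ℝ)
  have hc : Tendsto c atTop (𝓝 0) := by
    refine Dp.tendsto_zero_iff.2 ⟨?_, hc0 1⟩
    simp only [energy_eq_pSum]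
    refine tendsto_pSum_zero (v := fun _ => 0) (a := grad S f) f.pSummable_grad
      (fun _ => PSummable.zero) (by simp [pSum, Real.zero_rpow h0.ne']) (fun n i => ?_) fun i => ?_
    · rw [Pi.zero_apply, norm_zero, zero_add]
      exact (norm_grad_lipComp_le _ (lipschitzWith_clamp _) f i).trans_eq (one_mul _)
    · simpa [grad_apply] using (hc0 (i.2 * (i.1.1)⁻¹)).sub (hc0 i.2)
  have hlim : Tendsto (fun n => f - c n) atTop (𝓝 f) := by
    simpa using hc.const_sub f
  refine mem_nullSpace_of_tendsto hlim fun n => ?_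
  have hε : 0 < 1 / ((n : ℝ) + 1) := by positivity
  obtain ⟨b, hb, hb1⟩ := (Metric.tendsto_nhds.1 h) _ hε
  -- The cutoff min(|b|, 1) equals 1 wherever |f| ≥ 1/(n+1), so multiplying `f - c n` by it changes
  -- nothing, and the product is in the null space.
  have hθ := lipComp_mem_nullSpace _ lipschitzWith_min_norm_one (by simp) hb
  obtain ⟨M, hM⟩ := hf
  refine mul_mem_nullSpace (f := f - c n) hθ ⟨1, fun g => ?_⟩
    ⟨M + 2 * (1 / ((n : ℝ) + 1)), fun g => (norm_sub_le _ _).trans (add_le_add (hM g) (hcn n g))⟩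
    fun g => ?_
  · rw [Dp.lipComp_apply, Complex.norm_real, Real.norm_of_nonneg (by positivity)]
    exact min_le_right _ _
  · rw [Dp.lipComp_apply]
    by_cases hg : ‖f g‖ < 1 / ((n : ℝ) + 1)
    · have : (f - c n) g = 0 := by
        rw [Dp.sub_apply, sub_eq_zero]
        exact (clamp_eq_self hg.le).symm
      rw [this, mul_zero]
    · rw [min_eq_right (hb1 g fun h' => hg (by simpa using h'))]
      simp

theorem exists_tendsto_of_isBdd (l : Ultrafilter G) {f : G → ℂ} (hf : IsBdd f) :
    ∃ c, Tendsto f l (𝓝 c) := by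
  obtain ⟨M, hM⟩ := hf
  have := (isCompact_closedBall (0 : ℂ) M).ultrafilter_le_nhds (l.map f)
    (le_principal_iff.2 (by
      rw [Ultrafilter.mem_coe, Ultrafilter.mem_map]
      exact Filter.univ_mem' fun g => by simpa using hM g))
  obtain ⟨c, -, hc⟩ := this
  exact ⟨c, hc⟩

/-- The limit along an ultrafilter, as a character. -/
theorem exists_char_of_ultrafilter (l : Ultrafilter G) :
    ∃ x : Sp S p, ∀ f : BDp S p, Tendsto f.1 l (𝓝 (x f)) := by
  choose x hx using fun f : BDp S p => exists_tendsto_of_isBdd l f.2.2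
  exact ⟨{ toFun := x
           map_one' := tendsto_nhds_unique (hx 1) tendsto_const_nhds
           map_mul' := fun a b => tendsto_nhds_unique (hx _) ((hx a).mul (hx b))
           map_zero' := tendsto_nhds_unique (hx 0) tendsto_const_nhds
           map_add' := fun a b => tendsto_nhds_unique (hx _) ((hx a).add (hx b))
           commutes' := fun c => tendsto_nhds_unique (hx _) tendsto_const_nhds }, hx⟩

/-- The point mass at g is finitely supported, yet evaluation at g sends it to 1. Hence the
vanishing condition alone puts a character in the boundary. -/
theorem not_mem_range_evalChar {x : Sp S p}
    (hx : ∀ f : BDp S p, BDp.toDp f ∈ closure (finSupp S p) → x f = 0) :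
    x ∉ Set.range (evalChar S p) := by
  rintro ⟨g, rfl⟩
  classical
  have hfin : (Function.support (Pi.single g (1 : ℂ) : G → ℂ)).Finite :=
    (Set.finite_singleton g).subset Pi.support_single_subset
  let d : BDp S p := ⟨Pi.single g 1, (pSummable_of_finite_support hfin).mem_dirichlet, 1,
    fun k => by rw [Pi.single_apply]; split_ifs <;> simp⟩
  have h1 : evalChar S p g d = 1 := Pi.single_eq_same (M := fun _ => ℂ) g 1
  exact one_ne_zero (h1.symm.trans (hx d (subset_closure hfin)))

theorem sup_eq_top_of_harmonicBoundary_subsingleton (h : (harmonicBoundary S p).Subsingleton) :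
    nullSpace S p ⊔ constants S p = ⊤ := by
  refine sup_eq_top_of_bounded fun f hf => ?_
  let f' : BDp S p := ⟨f, f.mem, hf⟩
  have hchar : ∀ l : Ultrafilter G, ↑l ≤ nullFilter S p →
      ∃ x ∈ harmonicBoundary S p, Tendsto f l (𝓝 (x f')) := by
    intro l hl
    obtain ⟨x, hx⟩ := exists_char_of_ultrafilter (S := S) (p := p) l
    have h0 : ∀ k : BDp S p, BDp.toDp k ∈ closure (finSupp S p) → x k = 0 := fun k hk =>
      tendsto_nhds_unique (hx k) ((tendsto_nullFilter_of_mem_nullSpace hk).mono_left hl)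
    exact ⟨x, ⟨not_mem_range_evalChar h0, h0⟩, hx f'⟩
  have hc : ∃ c : ℂ, Tendsto f (nullFilter S p) (𝓝 c) := by
    rcases (harmonicBoundary S p).eq_empty_or_nonempty with he | ⟨x, hx⟩
    -- With an empty boundary no ultrafilter is finer than `nullFilter S p`, so any limit would do.
    · refine ⟨0, (tendsto_iff_ultrafilter _ _ _).2 fun l hl => ?_⟩
      obtain ⟨x, hx, -⟩ := hchar l hl
      simp [he] at hx
    · refine ⟨x f', (tendsto_iff_ultrafilter _ _ _).2 fun l hl => ?_⟩
      obtain ⟨y, hy, hy'⟩ := hchar l hl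
      rwa [h hx hy]
  obtain ⟨c, hc⟩ := hc
  let k : Dp S p := Dp.of (fun _ => c) (const_mem_dirichlet c)
  have hk : k ∈ constants S p := ⟨c, fun _ => rfl⟩
  obtain ⟨M, hM⟩ := hf
  have hfk : f - k ∈ nullSpace S p := by
    refine mem_nullSpace_of_tendsto_nullFilter ⟨M + ‖c‖, fun g => ?_⟩ ?_
    · exact (norm_sub_le _ _).trans (add_le_add_left (hM g) _)
    · exact tendsto_sub_nhds_zero_iff.2 hc
  exact sub_add_cancel f k ▸ Submodule.add_mem_sup hfk hk

end Boundary

/-! ### Summation by parts and the variational characterisation of p-harmonicity. -/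

section Green

variable {G : Type*} [Group G] {S : SymmGenSet G} {p : ℝ} [hp : Fact (1 ≤ p)]

/-- The flux `|∂f| ^ (p - 2) ∂f`. -/
def flux (S : SymmGenSet G) (p : ℝ) (f : G → ℂ) : S.carrier × G → ℂ := fun i =>
  ((‖grad S f i‖ ^ (p - 2) : ℝ) : ℂ) * grad S f i

theorem sum_flux (f : G → ℂ) (g : G) : ∑ s : S.carrier, flux S p f (s, g) = pLaplacian S p f g :=
  Finset.sum_coe_sort S.carrier
    fun s => ((‖f (g * s⁻¹) - f g‖ ^ (p - 2) : ℝ) : ℂ) * (f (g * s⁻¹) - f g)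

/-- Reversal of the oriented edges of the Cayley graph. -/
def edgeReverse (S : SymmGenSet G) : S.carrier × G ≃ S.carrier × G where
  toFun i := (⟨i.1.1⁻¹, S.inv_mem _ i.1.2⟩, i.2 * i.1.1⁻¹)
  invFun i := (⟨i.1.1⁻¹, S.inv_mem _ i.1.2⟩, i.2 * i.1.1⁻¹)
  left_inv i := by ext <;> simp
  right_inv i := by ext <;> simp

theorem grad_edgeReverse (f : G → ℂ) (i : S.carrier × G) :
    grad S f (edgeReverse S i) = -grad S f i := by
  simp [grad_apply, edgeReverse]

theorem flux_edgeReverse (f : G → ℂ) (i : S.carrier × G) :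
    flux S p f (edgeReverse S i) = -flux S p f i := by
  simp [flux, grad_edgeReverse]

theorem grad_support_finite {u : G → ℂ} (hu : u.support.Finite) :
    (grad S u).support.Finite := by
  have h1 : ((fun i : S.carrier × G => i.2) ⁻¹' u.support ∩ Set.univ).Finite := by
    refine (Set.finite_univ.prod hu).subset fun i hi => ⟨trivial, hi.1⟩
  have h2 : (edgeReverse S ⁻¹' ((fun i : S.carrier × G => i.2) ⁻¹' u.support ∩ Set.univ)).Finite :=
    h1.preimage (edgeReverse S).injective.injOn
  refine (h1.union h2).subset fun i hi => ?_
  by_contra h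
  simp only [Set.inter_univ, Set.mem_union, Set.mem_preimage, Function.mem_support, not_or,
    not_not] at h
  exact hi (by rw [grad_apply, h.1]; simpa [edgeReverse] using h.2)

/-- Summation by parts. -/
theorem tsum_conj_grad_mul_flux (f : G → ℂ) {u : G → ℂ} (hu : u.support.Finite) :
    ∑' i, starRingEnd ℂ (grad S u i) * flux S p f i =
      -2 * ∑' g, starRingEnd ℂ (u g) * pLaplacian S p f g := by
  -- Each edge contributes at its two endpoints. Reversing the edges turns the far endpoint into the
  -- near one, since the flux is odd; this produces the factor -2.
  let k : S.carrier × G → ℂ := fun i => starRingEnd ℂ (u i.2) * flux S p f i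
  have hk : Summable k := by
    refine summable_of_hasFiniteSupport ((Set.finite_univ.prod hu).subset fun i hi => ⟨trivial, ?_⟩)
    intro h
    exact hi (by simp [k, h])
  have hk' : Summable fun i => k (edgeReverse S i) := (edgeReverse S).summable_iff.2 hk
  have h1 : ∀ i, starRingEnd ℂ (grad S u i) * flux S p f i = -k (edgeReverse S i) - k i := by
    intro i
    simp only [k, flux_edgeReverse, grad_apply, map_sub]
    simp only [edgeReverse, Equiv.coe_fn_mk]
    ring
  have h2 : ∑' i, k i = ∑' g, starRingEnd ℂ (u g) * pLaplacian S p f g := by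
    refine ((Equiv.prodComm G S.carrier).tsum_eq k).symm.trans
      ((Summable.tsum_prod ((Equiv.prodComm G S.carrier).summable_iff.2 hk)).trans ?_)
    refine tsum_congr fun g => ?_
    rw [tsum_fintype, ← sum_flux, Finset.mul_sum]
    rfl
  rw [tsum_congr h1, Summable.tsum_sub hk'.neg hk, tsum_neg, (edgeReverse S).tsum_eq k, h2]
  ring

theorem energy_add_sub_energy (f u : Dp S p) {F : Finset (S.carrier × G)}
    (hF : ∀ i ∉ F, grad S u i = 0) :
    energy (f + u) - energy f = ∑ i ∈ F, (‖grad S f i + grad S u i‖ ^ p - ‖grad S f i‖ ^ p) := by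
  rw [energy_eq_pSum, energy_eq_pSum, pSum, pSum,
    ← Summable.tsum_sub (f + u).pSummable_grad f.pSummable_grad, tsum_eq_sum (s := F)]
  · simp only [grad_add, Pi.add_apply]
  · intro i hi
    simp [grad_add, hF i hi]

/-- Up to the factor p, this is the derivative of |z|^p at the gradient of `f` in direction `b`. It
links summation by parts with the variation of the energy. -/
theorem conj_mul_flux_re (f : G → ℂ) (i : S.carrier × G) (b : ℂ) :
    (starRingEnd ℂ b * flux S p f i).re = ‖grad S f i‖ ^ (p - 2) * inner ℝ (grad S f i) b := by
  rw [flux, Complex.inner, mul_left_comm, Complex.re_ofReal_mul]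
  simp only [Complex.mul_re, Complex.conj_re, Complex.conj_im]
  ring

/-- The convex function |z|^p lies above its tangent at a. This follows from Young's inequality for
|a + b| and |a|^(p-1), together with ⟨a, a + b⟩ ≤ |a||a + b|. -/
theorem norm_add_rpow_ge (hp1 : 1 < p) (a b : ℂ) :
    ‖a‖ ^ p + p * (‖a‖ ^ (p - 2) * inner ℝ a b) ≤ ‖a + b‖ ^ p := by
  rcases eq_or_ne a 0 with rfl | ha
  · simp [Real.zero_rpow (by linarith : p ≠ 0)]; positivity
  have ha' : 0 < ‖a‖ := norm_pos_iff.2 ha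
  have hpq := Real.HolderConjugate.conjExponent hp1
  have hy := Real.young_inequality_of_nonneg (norm_nonneg (a + b))
    (Real.rpow_nonneg ha'.le (p - 1)) hpq
  rw [← Real.rpow_mul ha'.le, Real.conjExponent, mul_div_cancel₀ p (by linarith : p - 1 ≠ 0)] at hy
  have h1 : inner ℝ a (a + b) ≤ ‖a‖ * ‖a + b‖ := real_inner_le_norm a (a + b)
  rw [inner_add_right, real_inner_self_eq_norm_sq] at h1
  have h2 : ‖a‖ ^ (p - 1) = ‖a‖ ^ (p - 2) * ‖a‖ := by
    rw [← Real.rpow_add_one ha'.ne']; congr 1; ring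
  have h3 : ‖a‖ ^ p = ‖a‖ ^ (p - 2) * ‖a‖ ^ 2 := by
    rw [← Real.rpow_natCast, ← Real.rpow_add ha']; congr 1; push_cast; ring
  have h4 := mul_le_mul_of_nonneg_left h1 (Real.rpow_nonneg ha'.le (p - 2))
  have h5 : ‖a‖ ^ p / (p / (p - 1)) = ‖a‖ ^ p - ‖a‖ ^ p / p := by
    field_simp
  rw [h5, h2] at hy
  have h6 : ‖a‖ ^ p + ‖a‖ ^ (p - 2) * inner ℝ a b ≤
      ‖a + b‖ ^ p / p + (‖a‖ ^ p - ‖a‖ ^ p / p) := by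
    refine le_trans ?_ hy
    nlinarith
  have h7 := mul_le_mul_of_nonneg_left h6 (zero_le_one.trans hp1.le)
  have h8 : p * (‖a + b‖ ^ p / p + (‖a‖ ^ p - ‖a‖ ^ p / p)) = ‖a + b‖ ^ p + p * ‖a‖ ^ p - ‖a‖ ^ p := by
    field_simp; ring
  rw [h8] at h7
  linarith

/-- A `p`-harmonic function minimises the energy among its finitely supported perturbations. -/
theorem energy_le_of_pLaplacian_eq_zero (hp1 : 1 < p) {f : Dp S p}
    (hf : ∀ g, pLaplacian S p f g = 0) {u : Dp S p} (hu : u ∈ finSupp S p) :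
    energy f ≤ energy (f + u) := by
  have hfin := grad_support_finite (S := S) hu
  have hF : ∀ i ∉ hfin.toFinset, grad S u i = 0 := fun i hi => by simpa using hi
  have hG := congrArg Complex.re (tsum_conj_grad_mul_flux (S := S) (p := p) f hu)
  rw [tsum_eq_sum (s := hfin.toFinset) fun i hi => by simp [hF i hi], Complex.re_sum] at hG
  simp only [hf, mul_zero, tsum_zero, Complex.zero_re, conj_mul_flux_re] at hG
  rw [← sub_nonneg, energy_add_sub_energy f u hF, ← mul_zero p, ← hG, Finset.mul_sum]
  exact Finset.sum_le_sum fun i _ => by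
    have := norm_add_rpow_ge hp1 (grad S f i) (grad S u i); linarith

/-- A minimiser of the energy among finitely supported perturbations is `p`-harmonic. -/
theorem pLaplacian_eq_zero_of_energy_le (hp1 : 1 < p) {f : Dp S p}
    (hf : ∀ u ∈ finSupp S p, energy f ≤ energy (f + u)) (x : G) : pLaplacian S p f x = 0 := by
  classical
  -- The perturbation by `c` times the point mass at `x` is chosen so that the derivative of the
  -- energy in its direction is -2p|c|².
  set c := pLaplacian S p f x with hc
  have hs : (Function.support (Pi.single x c : G → ℂ)).Finite :=
    (Set.finite_singleton x).subset Pi.support_single_subset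
  let u : Dp S p := Dp.of (Pi.single x c) (pSummable_of_finite_support hs).mem_dirichlet
  have hu : u ∈ finSupp S p := hs
  have hfin := grad_support_finite (S := S) hu
  have hF : ∀ i ∉ hfin.toFinset, grad S u i = 0 := fun i hi => by simpa using hi
  have hderiv : HasDerivAt
      (fun t : ℝ => ∑ i ∈ hfin.toFinset, ‖grad S f i + t • grad S u i‖ ^ p)
      (∑ i ∈ hfin.toFinset, p * (‖grad S f i‖ ^ (p - 2) * inner ℝ (grad S f i) (grad S u i))) 0 := by
    refine HasDerivAt.fun_sum fun i _ => ?_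
    have h1 : HasDerivAt (fun t : ℝ => grad S f i + t • grad S u i) (grad S u i) 0 := by
      simpa using ((hasDerivAt_id (0 : ℝ)).smul_const (grad S u i)).const_add (grad S f i)
    have h2 := (hasFDerivAt_norm_rpow (grad S f i + (0 : ℝ) • grad S u i) hp1).comp_hasDerivAt
      (0 : ℝ) h1
    refine h2.congr_deriv ?_
    simp only [zero_smul, add_zero, smul_apply, innerSL_apply_apply,
      smul_eq_mul, mul_assoc]
  have hmin : IsLocalMin
      (fun t : ℝ => ∑ i ∈ hfin.toFinset, ‖grad S f i + t • grad S u i‖ ^ p) 0 := by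
    refine Eventually.of_forall fun t => ?_
    have h1 := hf ((t : ℂ) • u) ((finSuppSubmodule S p).smul_mem _ hu)
    rw [← sub_nonneg, energy_add_sub_energy f _ (F := hfin.toFinset) (fun i hi => by
      rw [grad_smul, Pi.smul_apply, hF i hi, smul_zero]), Finset.sum_sub_distrib, sub_nonneg] at h1
    simp only [grad_smul, Pi.smul_apply] at h1
    simpa using h1
  have h0 := hmin.hasDerivAt_eq_zero hderiv
  have hG := congrArg Complex.re (tsum_conj_grad_mul_flux (S := S) (p := p) f hu)
  rw [tsum_eq_sum (s := hfin.toFinset) fun i hi => by simp [hF i hi], Complex.re_sum,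
    tsum_eq_single x fun g hg => by
      simp [u, Dp.of_apply, Pi.single_eq_of_ne hg]] at hG
  simp only [conj_mul_flux_re] at hG
  rw [← Finset.mul_sum, hG, ← hc, show u x = c from
    Pi.single_eq_same (M := fun _ => ℂ) x c, ← Complex.normSq_eq_conj_mul_self] at h0
  have : Complex.normSq c = 0 := by
    have h2 : (-2 * (Complex.normSq c : ℂ)).re = -2 * Complex.normSq c := by simp
    rw [h2] at h0
    rcases mul_eq_zero.1 h0 with h | h
    · linarith
    · linarith
  exact Complex.normSq_eq_zero.1 this

/-- By continuity of the energy, a p-harmonic f also minimises it under perturbations from the null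
space. If f = b + k with k constant, subtracting b leaves energy zero, so f has energy zero. -/
theorem HDp_eq_of_sup_eq_top (hp1 : 1 < p) (h : nullSpace S p ⊔ constants S p = ⊤) :
    HDp S p = {f | ∃ c : ℂ, f = fun _ => c} := by
  ext f
  constructor
  · rintro ⟨hf, hL⟩
    let f' : Dp S p := Dp.of f hf
    obtain ⟨b, hb, k, hk, hbk⟩ :=
      Submodule.mem_sup.1 (h ▸ Submodule.mem_top : f' ∈ nullSpace S p ⊔ constants S p)
    obtain ⟨u, hu, hlim⟩ := exists_seq_of_mem_nullSpace (neg_mem hb)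
    have h1 : energy f' ≤ energy (f' + -b) :=
      ge_of_tendsto' (Dp.tendsto_energy (hlim.const_add f')) fun n =>
        energy_le_of_pLaplacian_eq_zero hp1 (f := f') hL (hu n)
    have h2 : f' + -b = k := by rw [← hbk]; abel
    rw [h2, energy_of_mem_constants hk] at h1
    exact ⟨f' 1, funext (energy_eq_zero (le_antisymm h1 (energy_nonneg f')))⟩
  · rintro ⟨c, rfl⟩
    exact ⟨const_mem_dirichlet c, fun g => by simp [pLaplacian]⟩

theorem BHDp_eq_of_HDp_eq (h : HDp S p = {f | ∃ c : ℂ, f = fun _ => c}) :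
    BHDp S p = {f | ∃ c : ℂ, f = fun _ => c} := by
  rw [BHDp, h]
  ext f
  constructor
  · exact fun hf => hf.1
  · rintro ⟨c, rfl⟩
    exact ⟨⟨c, rfl⟩, ‖c‖, fun _ => le_rfl⟩

end Green

/-! ### Uniform convexity. -/

section Convexity

variable {p : ℝ}

/-- Strictness has two sources: the strictly convex norm of ℂ when |a| = |b|, and the strictly
convex power t^p otherwise. -/
theorem norm_half_add_rpow_lt (hp1 : 1 < p) {a b : ℂ} (hab : a ≠ b) :
    ‖(1 / 2 : ℂ) * (a + b)‖ ^ p < (‖a‖ ^ p + ‖b‖ ^ p) / 2 := by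
  have h0 : 0 < p := one_pos.trans hp1
  have htri : ‖(1 / 2 : ℂ) * (a + b)‖ ≤ (‖a‖ + ‖b‖) / 2 := by
    rw [norm_mul]
    have := norm_add_le a b
    norm_num; linarith
  rcases eq_or_ne ‖a‖ ‖b‖ with h | h
  · have h1 := (norm_midpoint_lt_iff h).2 hab
    rw [show (1 / 2 : ℝ) • (a + b) = (1 / 2 : ℂ) * (a + b) by
      rw [Complex.real_smul]; push_cast; ring] at h1
    rw [← h, add_self_div_two]
    exact Real.rpow_lt_rpow (norm_nonneg _) h1 h0
  · have h1 := (strictConvexOn_rpow hp1).2 (norm_nonneg a) (norm_nonneg b) h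
      (by norm_num : (0 : ℝ) < 1 / 2) (by norm_num : (0 : ℝ) < 1 / 2) (by norm_num)
    simp only [smul_eq_mul] at h1
    calc ‖(1 / 2 : ℂ) * (a + b)‖ ^ p ≤ (1 / 2 * ‖a‖ + 1 / 2 * ‖b‖) ^ p :=
          Real.rpow_le_rpow (norm_nonneg _) (by linarith) h0.le
      _ < _ := by linarith

theorem norm_half_add_rpow_le (hp1 : 1 < p) (a b : ℂ) :
    ‖(1 / 2 : ℂ) * (a + b)‖ ^ p ≤ (‖a‖ ^ p + ‖b‖ ^ p) / 2 := by
  rcases eq_or_ne a b with rfl | h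
  · rw [add_self_div_two]
    apply le_of_eq; congr 2; ring
  · exact (norm_half_add_rpow_lt hp1 h).le

/-- A form of uniform convexity of `|z| ^ p`. -/
theorem exists_uniform_convexity (hp1 : 1 < p) {ε : ℝ} (hε : 0 < ε) :
    ∃ C, 0 ≤ C ∧ ∀ a b : ℂ, ‖a - b‖ ^ p ≤ ε * (‖a‖ ^ p + ‖b‖ ^ p) +
      C * ((‖a‖ ^ p + ‖b‖ ^ p) / 2 - ‖(1 / 2 : ℂ) * (a + b)‖ ^ p) := by
  have h0 : 0 < p := one_pos.trans hp1
  let d : ℂ × ℂ → ℝ := fun z => (‖z.1‖ ^ p + ‖z.2‖ ^ p) / 2 - ‖(1 / 2 : ℂ) * (z.1 + z.2)‖ ^ p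
  have hd0 : ∀ z, 0 ≤ d z := fun z => sub_nonneg.2 (norm_half_add_rpow_le hp1 _ _)
  have hcont : ∀ {k : ℂ × ℂ → ℂ}, Continuous k → Continuous fun z => ‖k z‖ ^ p := fun hk =>
    hk.norm.rpow_const fun _ => Or.inr h0.le
  have hdc : Continuous d :=
    (((hcont continuous_fst).add (hcont continuous_snd)).div_const 2).sub
      (hcont (continuous_const.mul (continuous_fst.add continuous_snd)))
  -- On this compact set of normalised, well separated pairs the convexity defect `d` has a positive
  -- lower bound m. Homogeneity carries the bound to all separated pairs.
  let K : Set (ℂ × ℂ) := {z | ‖z.1‖ ^ p + ‖z.2‖ ^ p = 1 ∧ ε ≤ ‖z.1 - z.2‖ ^ p}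
  have hKc : IsCompact K := by
    refine (isCompact_closedBall (0 : ℂ × ℂ) 1).of_isClosed_subset ?_ ?_
    · exact (isClosed_eq ((hcont continuous_fst).add (hcont continuous_snd)) continuous_const).inter
        (isClosed_le continuous_const (hcont (continuous_fst.sub continuous_snd)))
    · rintro ⟨a, b⟩ ⟨h, -⟩
      have ha : ‖a‖ ^ p ≤ 1 ^ p := by
        rw [Real.one_rpow, ← h]; exact le_add_of_nonneg_right (by positivity)
      have hb : ‖b‖ ^ p ≤ 1 ^ p := by
        rw [Real.one_rpow, ← h]; exact le_add_of_nonneg_left (by positivity)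
      rw [Real.rpow_le_rpow_iff (norm_nonneg _) zero_le_one h0] at ha hb
      simpa [Prod.norm_def] using ⟨ha, hb⟩
  have hm : ∃ m, 0 < m ∧ ∀ z ∈ K, m ≤ d z := by
    rcases K.eq_empty_or_nonempty with he | hne
    · exact ⟨1, one_pos, by simp [he]⟩
    · obtain ⟨z, hz, hmin⟩ := hKc.exists_isMinOn hne hdc.continuousOn
      refine ⟨d z, sub_pos.2 (norm_half_add_rpow_lt hp1 fun h => ?_), fun w hw => hmin hw⟩
      have h2 := hz.2
      rw [h, sub_self, norm_zero, Real.zero_rpow h0.ne'] at h2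
      linarith
  obtain ⟨m, hm0, hm⟩ := hm
  -- Always |a - b|^p ≤ 2^p R, while the defect of a separated pair is at least mR.
  refine ⟨2 ^ p / m, by positivity, fun a b => ?_⟩
  set R := ‖a‖ ^ p + ‖b‖ ^ p with hR
  have hR0 : 0 ≤ R := by positivity
  have hsub : ‖a - b‖ ^ p ≤ 2 ^ p * R :=
    (Real.rpow_le_rpow (norm_nonneg _) (norm_sub_le _ _) h0.le).trans
      (add_rpow_le_two_rpow_mul (norm_nonneg _) (norm_nonneg _) h0.le)
  have hdab : 0 ≤ R / 2 - ‖(1 / 2 : ℂ) * (a + b)‖ ^ p := hd0 (a, b)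
  by_cases hsmall : ‖a - b‖ ^ p ≤ ε * R
  · have : 0 ≤ 2 ^ p / m * (R / 2 - ‖(1 / 2 : ℂ) * (a + b)‖ ^ p) := by positivity
    linarith
  · have hRpos : 0 < R := by
      refine lt_of_le_of_ne hR0 fun h => ?_
      rw [← h, mul_zero] at hsub hsmall
      exact hsmall hsub
    let r : ℝ := R ^ (-(1 / p))
    have hr0 : 0 ≤ r := Real.rpow_nonneg hR0 _
    have hrp : r ^ p = R⁻¹ := by
      rw [← Real.rpow_mul hR0, neg_mul, one_div_mul_cancel h0.ne', Real.rpow_neg_one]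
    have hscale : ∀ z : ℂ, ‖(r : ℂ) * z‖ ^ p = R⁻¹ * ‖z‖ ^ p := fun z => by
      rw [norm_mul, Complex.norm_real, Real.norm_of_nonneg hr0,
        Real.mul_rpow hr0 (norm_nonneg _), hrp]
    have hz : ((r : ℂ) * a, (r : ℂ) * b) ∈ K := by
      refine ⟨?_, ?_⟩
      · simp only [hscale]
        rw [← mul_add, ← hR, inv_mul_cancel₀ hRpos.ne']
      · simp only [← mul_sub, hscale]
        rw [inv_mul_eq_div, le_div_iff₀ hRpos]
        exact (not_le.1 hsmall).le
    have h1 := hm _ hz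
    simp only [d] at h1
    rw [← mul_add (r : ℂ), mul_left_comm, hscale, hscale, hscale] at h1
    have h2 : m * R ≤ R / 2 - ‖(1 / 2 : ℂ) * (a + b)‖ ^ p := by
      have h3 := mul_le_mul_of_nonneg_right h1 hR0
      have h4 : ((R⁻¹ * ‖a‖ ^ p + R⁻¹ * ‖b‖ ^ p) / 2 - R⁻¹ * ‖(1 / 2 : ℂ) * (a + b)‖ ^ p) * R =
          R / 2 - ‖(1 / 2 : ℂ) * (a + b)‖ ^ p := by
        rw [← mul_add, ← hR]; field_simp
      rwa [h4] at h3
    have h3 : 2 ^ p * R ≤ 2 ^ p / m * (R / 2 - ‖(1 / 2 : ℂ) * (a + b)‖ ^ p) := by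
      rw [div_mul_eq_mul_div, le_div_iff₀ hm0, mul_assoc, mul_comm R]
      gcongr
    have h4 : 0 ≤ ε * R := by positivity
    linarith

/-- A form of uniform convexity of `ℓ^p`. -/
theorem exists_pSum_uniform_convexity [hp : Fact (1 ≤ p)] (hp1 : 1 < p) {ε : ℝ} (hε : 0 < ε) :
    ∃ C, 0 ≤ C ∧ ∀ (ι : Type*) (u v : ι → ℂ), PSummable p u → PSummable p v →
      pSum p (u - v) ≤ ε * (pSum p u + pSum p v) +
        C * ((pSum p u + pSum p v) / 2 - pSum p ((1 / 2 : ℂ) • (u + v))) := by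
  obtain ⟨C, hC, h⟩ := exists_uniform_convexity hp1 hε
  refine ⟨C, hC, fun ι u v hu hv => ?_⟩
  have hw := (hu.add hv).const_smul (1 / 2 : ℂ)
  have h1 := (Summable.add hu hv).mul_left ε
  have h2 := (((Summable.add hu hv).div_const 2).sub hw).mul_left C
  simp only [pSum]
  rw [← Summable.tsum_add hu hv, ← tsum_div_const,
    ← Summable.tsum_sub ((Summable.add hu hv).div_const 2) hw, ← tsum_mul_left, ← tsum_mul_left,
    ← Summable.tsum_add h1 h2]
  exact Summable.tsum_le_tsum (fun i => h (u i) (v i)) (hu.sub hv) (h1.add h2)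

end Convexity

/-! ### Energy minimisation and the Royden decomposition. -/

section Royden

variable {G : Type*} [Group G] {S : SymmGenSet G} {p : ℝ} [hp : Fact (1 ≤ p)]

/-- Uniformly bounded functions form an energy-complete space. -/
theorem exists_limit_of_energy_cauchy {u : ℕ → Dp S p} {M : ℝ} (hM : ∀ n g, ‖u n g‖ ≤ M)
    (hu : ∀ ε > 0, ∃ N, ∀ m ≥ N, ∀ n ≥ N, energy (u m - u n) ≤ ε) :
    ∃ (h : Dp S p) (l : Filter ℕ), l.NeBot ∧ l ≤ atTop ∧ Tendsto u l (𝓝 h) ∧ IsBdd h := by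
  have h0 : 0 < p := lt_of_lt_of_le one_pos hp.out
  -- A nonprincipal ultrafilter yields pointwise limits at all g at once, without extracting
  -- subsequences.
  let l : Ultrafilter ℕ := hyperfilter ℕ
  have hl : (l : Filter ℕ) ≤ atTop := Nat.hyperfilter_le_atTop
  have hex : ∀ g, ∃ c ∈ Metric.closedBall (0 : ℂ) M, Tendsto (fun n => u n g) l (𝓝 c) := fun g => by
    refine (isCompact_closedBall (0 : ℂ) M).ultrafilter_le_nhds (l.map fun n => u n g)
      (le_principal_iff.2 ?_)
    rw [Ultrafilter.mem_coe, Ultrafilter.mem_map]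
    exact Filter.univ_mem' fun n => by simpa using hM n g
  choose h hhM hlim using hex
  have hgrad : ∀ i, Tendsto (fun n => grad S (u n) i) l (𝓝 (grad S h i)) := fun i =>
    (hlim _).sub (hlim _)
  -- Fatou's argument: the bound on finite partial sums passes to the pointwise limit and gives
  -- summability as well as the estimate.
  have hfatou : ∀ ε > 0, ∀ m, (∀ᶠ n in (l : Filter ℕ), energy (u m - u n) ≤ ε) →
      PSummable p (grad S (u m) - grad S h) ∧ pSum p (grad S (u m) - grad S h) ≤ ε := by
    intro ε hε m hm
    have hfin : ∀ F : Finset (S.carrier × G),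
        ∑ i ∈ F, ‖(grad S (u m) - grad S h) i‖ ^ p ≤ ε := by
      intro F
      have h1 : Tendsto (fun n => ∑ i ∈ F, ‖grad S (u m) i - grad S (u n) i‖ ^ p) l
          (𝓝 (∑ i ∈ F, ‖(grad S (u m) - grad S h) i‖ ^ p)) :=
        tendsto_finsetSum _ fun i _ =>
          ((hgrad i).const_sub (grad S (u m) i)).norm.rpow_const (Or.inr h0.le)
      refine le_of_tendsto h1 (hm.mono fun n hn => le_trans ?_ hn)
      rw [energy_eq_pSum, grad_sub]
      exact Summable.sum_le_tsum F (fun i _ => by positivity)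
        ((u m).pSummable_grad.sub (u n).pSummable_grad)
    exact ⟨summable_of_sum_le (fun i => by positivity) hfin,
      Real.tsum_le_of_sum_le (fun i => by positivity) hfin⟩
  have hev : ∀ ε > 0, ∃ N, ∀ m ≥ N, ∀ᶠ n in (l : Filter ℕ), energy (u m - u n) ≤ ε := by
    intro ε hε
    obtain ⟨N, hN⟩ := hu ε hε
    exact ⟨N, fun m hm => hl ((eventually_ge_atTop N).mono fun n hn => hN m hm n hn)⟩
  have hmem : h ∈ dirichletSubmodule S p := by
    obtain ⟨N, hN⟩ := hev 1 one_pos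
    rw [mem_dirichletSubmodule_iff]
    have := (u N).pSummable_grad.sub (hfatou 1 one_pos N (hN N le_rfl)).1
    rwa [sub_sub_cancel] at this
  refine ⟨Dp.of h hmem, l, inferInstance, hl, Dp.tendsto_iff.2 ⟨Tendsto.mono_left ?_ hl, hlim 1⟩, M,
    fun g => mem_closedBall_zero_iff.1 (hhM g)⟩
  rw [Metric.tendsto_atTop]
  intro ε hε
  obtain ⟨N, hN⟩ := hev (ε / 2) (half_pos hε)
  refine ⟨N, fun m hm => ?_⟩
  rw [Real.dist_0_eq_abs, abs_of_nonneg (energy_nonneg _), energy_eq_pSum, grad_sub]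
  exact ((hfatou _ (half_pos hε) m (hN m hm)).2).trans_lt (half_lt_self hε)

/-- The Royden decomposition of a bounded function. -/
theorem exists_royden_decomposition (hp1 : 1 < p) {f : Dp S p} (hf : IsBdd f) :
    ∃ h : Dp S p, (h : G → ℂ) ∈ BHDp S p ∧ f - h ∈ nullSpace S p := by
  obtain ⟨M, hM⟩ := hf
  have hM0 : 0 ≤ M := (norm_nonneg _).trans (hM 1)
  let E : Set ℝ := (fun u => energy (f + u)) '' finSupp S p
  have hEne : E.Nonempty := ⟨_, 0, (finSuppSubmodule S p).zero_mem, rfl⟩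
  have hEbdd : BddBelow E := ⟨0, by rintro _ ⟨u, _, rfl⟩; exact energy_nonneg _⟩
  set m := sInf E with hm
  have hmle : ∀ u ∈ finSupp S p, m ≤ energy (f + u) := fun u hu => csInf_le hEbdd ⟨u, hu, rfl⟩
  have hm0 : 0 ≤ m := le_csInf hEne (by rintro _ ⟨u, _, rfl⟩; exact energy_nonneg _)
  have hex : ∀ n : ℕ, ∃ u ∈ finSupp S p, energy (f + u) < m + 1 / ((n : ℝ) + 1) := fun n => by
    obtain ⟨_, ⟨u, hu, rfl⟩, h⟩ := exists_lt_of_csInf_lt hEne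
      (show sInf E < m + 1 / ((n : ℝ) + 1) from lt_add_of_pos_right _ (by positivity))
    exact ⟨u, hu, h⟩
  choose u hu hum using hex
  -- Truncation at the bound of `f` does not raise the energy and fixes `f` off the support of `u
  -- n`. So `w` is a uniformly bounded minimising sequence of finitely supported perturbations of
  -- `f`.
  let w : ℕ → Dp S p := fun n => (f + u n).lipComp (clamp M) (lipschitzWith_clamp M)
  have hwfin : ∀ n, w n - f ∈ finSupp S p := fun n => by
    refine Set.Finite.subset (hu n) fun g hg h => hg ?_
    change clamp M ((f + u n) g) - f g = 0
    rw [Dp.add_apply, h, add_zero, clamp_eq_self (hM g), sub_self]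
  have hwE : ∀ n, energy (w n) < m + 1 / ((n : ℝ) + 1) := fun n =>
    (energy_lipComp_le _ _ _).trans_lt (hum n)
  have hwmin : ∀ n, ∀ v ∈ finSupp S p, m ≤ energy (w n + v) := fun n v hv => by
    have := hmle (w n - f + v) ((finSuppSubmodule S p).add_mem (hwfin n) hv)
    rwa [show f + (w n - f + v) = w n + v by abel] at this
  have hcauchy : ∀ ε > 0, ∃ N, ∀ i ≥ N, ∀ j ≥ N, energy (w i - w j) ≤ ε := by
    intro ε hε
    -- For large indices both energies are at most m + 1, so this choice keeps the first term below
    -- ε/2. The midpoint is again a competitor, of energy at least m, so the defect is at most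
    -- ε/(2(C+1)); C + 1 avoids division by zero.
    obtain ⟨C, hC, hconv⟩ := exists_pSum_uniform_convexity (p := p) hp1
      (show 0 < ε / (2 * (2 * (m + 1))) by positivity)
    obtain ⟨N, hN⟩ := exists_nat_one_div_lt (show 0 < ε / (2 * (C + 1)) by positivity)
    refine ⟨N, fun i hi j hj => ?_⟩
    have hle : ∀ i ≥ N, energy (w i) ≤ m + ε / (2 * (C + 1)) ∧ energy (w i) ≤ m + 1 := fun i hi => by
      have h1 : 1 / ((i : ℝ) + 1) ≤ 1 / ((N : ℝ) + 1) := by gcongr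
      have h2 : 1 / ((i : ℝ) + 1) ≤ 1 := by
        rw [div_le_one (by positivity)]; linarith [(Nat.cast_nonneg i : (0 : ℝ) ≤ i)]
      have := hwE i
      constructor <;> linarith
    have h1 := hconv _ _ _ (w i).pSummable_grad (w j).pSummable_grad
    rw [← grad_sub, ← grad_add, ← grad_smul] at h1
    simp only [← energy_eq_pSum] at h1
    have h2 : m ≤ energy ((1 / 2 : ℂ) • (w i + w j)) := by
      have := hwmin i ((1 / 2 : ℂ) • ((w j - f) - (w i - f)))
        ((finSuppSubmodule S p).smul_mem _ ((finSuppSubmodule S p).sub_mem (hwfin j) (hwfin i)))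
      convert this using 2
      module
    obtain ⟨h3, h3'⟩ := hle i hi
    obtain ⟨h4, h4'⟩ := hle j hj
    refine h1.trans ?_
    have h5 : ε / (2 * (2 * (m + 1))) * (energy (w i) + energy (w j)) ≤ ε / 2 := by
      calc _ ≤ ε / (2 * (2 * (m + 1))) * (2 * (m + 1)) := by gcongr; linarith
        _ = ε / 2 := by field_simp
    have h6 : C * ((energy (w i) + energy (w j)) / 2 - energy ((1 / 2 : ℂ) • (w i + w j))) ≤
        ε / 2 := by
      calc _ ≤ (C + 1) * (ε / (2 * (C + 1))) := by
            have : (energy (w i) + energy (w j)) / 2 - energy ((1 / 2 : ℂ) • (w i + w j)) ≤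
              ε / (2 * (C + 1)) := by linarith
            have h7 : 0 < ε / (2 * (C + 1)) := by positivity
            calc _ ≤ C * (ε / (2 * (C + 1))) := by gcongr
              _ ≤ _ := by gcongr; linarith
        _ = ε / 2 := by field_simp
    linarith
  obtain ⟨h, l, hl, hlt, hlim, hbdd⟩ := exists_limit_of_energy_cauchy (u := w) (M := 2 * M)
    (fun n g => norm_clamp_le hM0 _) hcauchy
  have hEh : energy h ≤ m := by
    have h1 : Tendsto (fun n : ℕ => m + 1 / ((n : ℝ) + 1)) l (𝓝 m) := by
      simpa using (tendsto_one_div_add_atTop_nhds_zero_nat.const_add m).mono_left hlt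
    exact le_of_tendsto_of_tendsto' (Dp.tendsto_energy hlim) h1 fun n => (hwE n).le
  have hmin : ∀ v ∈ finSupp S p, energy h ≤ energy (h + v) := fun v hv =>
    hEh.trans (ge_of_tendsto' (Dp.tendsto_energy (hlim.add_const v)) fun n => hwmin n v hv)
  refine ⟨h, ⟨⟨h.mem, pLaplacian_eq_zero_of_energy_le hp1 hmin⟩, hbdd⟩, ?_⟩
  rw [← neg_sub]
  exact neg_mem (mem_nullSpace_of_tendsto (hlim.sub_const f) fun n =>
    finSupp_subset_nullSpace (hwfin n))

theorem sup_eq_top_of_BHDp_eq (hp1 : 1 < p) (h : BHDp S p = {f | ∃ c : ℂ, f = fun _ => c}) :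
    nullSpace S p ⊔ constants S p = ⊤ := by
  refine sup_eq_top_of_bounded fun f hf => ?_
  obtain ⟨k, hk, hfk⟩ := exists_royden_decomposition hp1 hf
  rw [h] at hk
  obtain ⟨c, hc⟩ := hk
  exact sub_add_cancel f k ▸ Submodule.add_mem_sup hfk (show k ∈ constants S p from
    ⟨c, fun g => congrFun hc g⟩)

end Royden

/-! ### Continuous translation invariant functionals. -/

section Functionals

variable {G : Type*} [Group G] {S : SymmGenSet G} {p : ℝ} [hp : Fact (1 ≤ p)]

/-- The energy is controlled by the `ℓ^p` norm. -/
theorem energy_le_mul_pSum {f : Dp S p} (hf : f ∈ ellp S p) :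
    energy f ≤ S.carrier.card * (2 ^ p * (pSum p f + pSum p f)) := by
  rw [energy, ← nsmul_eq_mul]
  refine Finset.sum_le_card_nsmul _ _ _ fun s _ => ?_
  have h1 := PSummable.translate (show PSummable p f from hf) s⁻¹
  have h2 : pSum p (fun g => f (g * s⁻¹)) = pSum p f :=
    (Equiv.mulRight s⁻¹).tsum_eq fun g => ‖f g‖ ^ p
  have h3 := pSum_add_le h1 (PSummable.const_smul (show PSummable p f from hf) (-1))
  rw [h2] at h3
  have h4 : pSum p ((-1 : ℂ) • (f : G → ℂ)) = pSum p f := by simp [pSum]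
  rw [h4] at h3
  refine le_trans (le_of_eq ?_) h3
  simp [pSum, diff, sub_eq_add_neg]

open Classical in
/-- The indicator function of a point. -/
def Dp.single (S : SymmGenSet G) (p : ℝ) [Fact (1 ≤ p)] (x : G) : Dp S p :=
  Dp.of (Pi.single x 1) (pSummable_of_finite_support
    ((Set.finite_singleton x).subset Pi.support_single_subset)).mem_dirichlet

open Classical in
theorem Dp.single_apply (x g : G) : Dp.single S p x g = if g = x then 1 else 0 := by
  rw [Dp.single, Dp.of_apply, Pi.single_apply]

theorem Dp.translate_single_one (x : G) : (Dp.single S p 1).translate x = Dp.single S p x := by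
  classical
  refine Dp.ext fun g => ?_
  rw [Dp.translate, Dp.of_apply, Dp.single_apply, Dp.single_apply]
  exact if_congr mul_inv_eq_one rfl rfl

theorem Dp.sum_apply {ι : Type*} (F : Finset ι) (u : ι → Dp S p) (g : G) :
    (∑ i ∈ F, u i) g = ∑ i ∈ F, u i g :=
  map_sum ({ toFun := fun f => f g, map_zero' := rfl, map_add' := fun _ _ => rfl } :
    Dp S p →+ ℂ) u F

theorem eq_sum_single_of_finSupp {f : Dp S p} (hf : (Function.support f).Finite) :
    f = ∑ x ∈ hf.toFinset, f x • Dp.single S p x := by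
  classical
  refine Dp.ext fun g => ?_
  rw [Dp.sum_apply]
  simp only [Dp.smul_apply, Dp.single_apply, mul_ite, mul_one, mul_zero]
  rw [Finset.sum_ite_eq]
  split_ifs with h
  · rfl
  · rw [Set.Finite.mem_toFinset, Function.mem_support, not_not] at h
    exact h

theorem IsTILF.apply_single {T : DpModC S p →ₗ[ℂ] ℂ} (hT : IsTILF T) (x : G) :
    T (Dp.single S p x).toModC = T (Dp.single S p 1).toModC := by
  rw [← Dp.translate_single_one, hT]

theorem pSum_sum_single (F : Finset G) :
    pSum p (∑ x ∈ F, Dp.single S p x : Dp S p) = F.card := by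
  classical
  have h0 : 0 < p := lt_of_lt_of_le one_pos hp.out
  have h : ∀ g, (∑ x ∈ F, Dp.single S p x : Dp S p) g = if g ∈ F then 1 else 0 := fun g => by
    rw [Dp.sum_apply]
    simp only [Dp.single_apply]
    rw [Finset.sum_ite_eq]
  rw [pSum, tsum_eq_sum (s := F) fun g hg => by simp [h, hg, Real.zero_rpow h0.ne']]
  rw [Finset.sum_congr rfl fun g hg => show _ = (1 : ℝ) by rw [h, if_pos hg]; simp]
  simp

theorem sum_single_mem_ellp (F : Finset G) : ∑ x ∈ F, Dp.single S p x ∈ ellp S p := by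
  classical
  exact sum_mem fun x _ => finSupp_subset_ellp
    ((Set.finite_singleton x).subset Pi.support_single_subset)

/-- Dividing by n gives c ≤ A n^(1/p - 1), which tends to zero because p > 1. -/
theorem eq_zero_of_mul_le_rpow (hp1 : 1 < p) {c A : ℝ} (hc : 0 ≤ c)
    (h : ∀ n : ℕ, c * n ≤ A * (n : ℝ) ^ (1 / p)) : c = 0 := by
  have h0 : 0 < p := one_pos.trans hp1
  have h1 : Tendsto (fun n : ℕ => A * (n : ℝ) ^ (-(1 - 1 / p))) atTop (𝓝 0) := by
    have : 0 < 1 - 1 / p := by rw [sub_pos, div_lt_one h0]; exact hp1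
    simpa using ((tendsto_rpow_neg_atTop this).comp tendsto_natCast_atTop_atTop).const_mul A
  refine le_antisymm (ge_of_tendsto h1 ((eventually_gt_atTop 0).mono fun n hn => ?_)) hc
  have hn' : (0 : ℝ) < n := Nat.cast_pos.2 hn
  rw [neg_sub, Real.rpow_sub_one hn'.ne', ← mul_div_assoc, le_div_iff₀ hn']
  exact h n

/-- On a sum of n distinct point masses, T equals n times its common value, while the norm of the
sum grows only like n^(1/p). Infinitude of G makes every n available. -/
theorem IsTILF.apply_single_eq_zero [Infinite G] (hp1 : 1 < p) {T : DpModC S p →ₗ[ℂ] ℂ}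
    (hT : IsTILF T) (hc : Continuous T) (x : G) : T (Dp.single S p x).toModC = 0 := by
  have h0 : 0 < p := one_pos.trans hp1
  rw [hT.apply_single, ← norm_eq_zero]
  let T' : DpModC S p →L[ℂ] ℂ := ⟨T, hc⟩
  set K : ℝ := S.carrier.card * (2 ^ p * 2) with hK
  refine eq_zero_of_mul_le_rpow hp1 (A := ‖T'‖ * K ^ (1 / p)) (norm_nonneg _) fun n => ?_
  obtain ⟨F, hF⟩ := Infinite.exists_subset_card_eq G n
  let u : Dp S p := ∑ x ∈ F, Dp.single S p x
  have h1 : T u.toModC = n * T (Dp.single S p 1).toModC := by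
    simp only [u, map_sum]
    rw [Finset.sum_congr rfl fun x _ => hT.apply_single x, Finset.sum_const, hF, nsmul_eq_mul]
  have h2 : ‖T u.toModC‖ ≤ ‖T'‖ * ‖u.toModC‖ := T'.le_opNorm _
  rw [h1, norm_mul, Complex.norm_natCast, norm_toModC, mul_comm] at h2
  refine h2.trans ?_
  rw [mul_assoc, ← Real.mul_rpow (by positivity) n.cast_nonneg]
  gcongr
  · exact energy_nonneg _
  · refine (energy_le_mul_pSum (sum_single_mem_ellp F)).trans (le_of_eq ?_)
    rw [pSum_sum_single, hF, hK]
    ring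

theorem IsTILF.eq_zero_of_continuous [Infinite G] (hp1 : 1 < p)
    (h : nullSpace S p ⊔ constants S p = ⊤) {T : DpModC S p →ₗ[ℂ] ℂ}
    (hT : IsTILF T) (hc : Continuous T) : T = 0 := by
  have hcont : Continuous fun f : Dp S p => T f.toModC :=
    hc.comp (constants S p).continuous_mkQ
  have h1 : ∀ f ∈ finSupp S p, T f.toModC = 0 := fun f hf => by
    rw [eq_sum_single_of_finSupp hf]
    simp only [map_sum, map_smul]
    exact Finset.sum_eq_zero fun x _ => by rw [hT.apply_single_eq_zero hp1 hc, smul_zero]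
  have h2 : ∀ f ∈ nullSpace S p, T f.toModC = 0 := fun f hf =>
    closure_minimal (s := finSupp S p) (t := {f | T f.toModC = 0}) h1
      (isClosed_singleton.preimage hcont) hf
  refine LinearMap.ext fun q => ?_
  obtain ⟨f, rfl⟩ := (constants S p).mkQ_surjective q
  obtain ⟨b, hb, k, hk, rfl⟩ := Submodule.mem_sup.1 (h ▸ Submodule.mem_top : f ∈ _)
  have hk0 : (constants S p).mkQ k = 0 := (Submodule.Quotient.mk_eq_zero _).2 hk
  rw [map_add, hk0, add_zero]
  exact h2 b hb

theorem Dp.translate_sub_mem_ellp (f : Dp S p) (x : G) : f.translate x - f ∈ ellp S p :=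
  diff_pSummable f x

/-- A translate of f differs from f by an element of ℓ^p, so every functional vanishing on the null
space and the constants is translation invariant. Hahn–Banach on the quotient by this closed
subspace provides a nonzero one if the quotient is not trivial. -/
theorem sup_eq_top_of_tilf
    (h : ∀ T : DpModC S p →ₗ[ℂ] ℂ, IsTILF T → Continuous T → T = 0) :
    nullSpace S p ⊔ constants S p = ⊤ := by
  have hcl : IsClosed ((nullSpace S p ⊔ constants S p : Submodule ℂ (Dp S p)) : Set (Dp S p)) :=
    Submodule.isClosed_sup_finiteDimensional _ _ isClosed_nullSpace
  set L := nullSpace S p ⊔ constants S p with hL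
  refine eq_top_iff.2 fun f _ => ?_
  by_contra hf
  have hne : ‖L.mkQ f‖ ≠ 0 := by
    intro h0
    rw [Submodule.mkQ_apply] at h0
    exact hf (hcl.closure_subset ((QuotientAddGroup.norm_mk_eq_zero_iff_mem_closure
      (S := L.toAddSubgroup)).1 h0))
  obtain ⟨φ, -, hφ⟩ := exists_dual_vector ℂ (L.mkQ f) hne
  have hker : ∀ k ∈ L, φ (L.mkQ k) = 0 := fun k hk => by
    rw [Submodule.mkQ_apply, (Submodule.Quotient.mk_eq_zero L).2 hk, map_zero]
  let T : DpModC S p →ₗ[ℂ] ℂ := (constants S p).liftQ (φ.toLinearMap ∘ₗ L.mkQ) fun k hk =>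
    hker k (hL ▸ Submodule.mem_sup_right hk)
  have hT : ∀ k : Dp S p, T k.toModC = φ (L.mkQ k) := fun k => rfl
  have h0 := h T (fun x k => ?_) ?_
  · have h1 := hT f
    rw [h0, hφ] at h1
    exact hne (by simpa using h1.symm)
  · rw [hT, hT, ← sub_eq_zero, ← map_sub, ← map_sub]
    exact hker _ (hL ▸ Submodule.mem_sup_left (ellp_le_nullSpace (k.translate_sub_mem_ellp x)))
  · exact (constants S p).isQuotientMap_mkQ.continuous_iff.2 (φ.continuous.comp L.continuous_mkQ)

end Functionals

/-! ### Isoperimetric inequalities of nonamenable groups. -/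

section Amenability

variable {G : Type*} [Group G] (S : SymmGenSet G)

/-- A finitely additive probability measure which is invariant under right translation by the
elements of `S` gives amenability. -/
theorem isAmenable_of_right_invariant {S : SymmGenSet G} (μ : Set G → ℝ) (h0 : ∀ A, 0 ≤ μ A)
    (h1 : μ Set.univ = 1) (hadd : ∀ A B, Disjoint A B → μ (A ∪ B) = μ A + μ B)
    (hinv : ∀ s ∈ S.carrier, ∀ A, μ {g | g * s ∈ A} = μ A) : IsAmenable G := by
  have hinv' : ∀ x ∈ Subgroup.closure (S.carrier : Set G), ∀ A, μ {g | g * x ∈ A} = μ A := by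
    intro x hx
    induction hx using Subgroup.closure_induction with
    | mem x hx => exact hinv x hx
    | one => simp
    | mul x y _ _ hx hy =>
      intro A
      rw [← hy A, ← hx {g | g * y ∈ A}]
      simp [mul_assoc]
    | inv x _ hx =>
      intro A
      rw [← hx {g | g * x⁻¹ ∈ A}]
      simp
  -- Inversion of sets turns right invariance into left invariance.
  refine ⟨fun A => ENNReal.ofReal (μ A⁻¹), by simp [h1], fun A B hAB => ?_, fun g A => ?_⟩
  · dsimp only
    have hAB' : Disjoint A⁻¹ B⁻¹ := hAB.preimage _
    rw [Set.union_inv, hadd _ _ hAB', ENNReal.ofReal_add (h0 _) (h0 _)]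
  · dsimp only
    rw [← hinv' g (by rw [S.closure_eq_top]; trivial) A⁻¹]
    congr 2
    ext h
    simp [Set.mem_smul_set_iff_inv_smul_mem]

/-- The `ℓ^1` isoperimetric inequality of a nonamenable group. -/
theorem exists_l1_isoperimetric (hG : ¬ IsAmenable G) :
    ∃ C, 0 ≤ C ∧ ∀ w : G → ℝ, (∀ g, 0 ≤ w g) → Summable w →
      ∑' g, w g ≤ C * ∑ s ∈ S.carrier, ∑' g, |w (g * s⁻¹) - w g| := by
  by_contra! hcon
  refine hG ?_
  -- A counterexample to the constant n + 1, normalised to mass 1, is an almost invariant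
  -- probability density. An ultrafilter limit of the measures `a n` is then an invariant mean.
  have hex : ∀ n : ℕ, ∃ w : G → ℝ, (∀ g, 0 ≤ w g) ∧ HasSum w 1 ∧
      ∑ s ∈ S.carrier, ∑' g, |w (g * s⁻¹) - w g| ≤ 1 / ((n : ℝ) + 1) := by
    intro n
    obtain ⟨w, hw0, hws, hw⟩ := hcon ((n : ℝ) + 1) (by positivity)
    set D := ∑ s ∈ S.carrier, ∑' g, |w (g * s⁻¹) - w g| with hD
    have hD0 : 0 ≤ D := Finset.sum_nonneg fun _ _ => tsum_nonneg fun _ => abs_nonneg _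
    have hpos : 0 < ∑' g, w g := lt_of_le_of_lt (by positivity) hw
    refine ⟨fun g => (∑' g, w g)⁻¹ * w g, fun g => mul_nonneg (by positivity) (hw0 g), ?_, ?_⟩
    · simpa [inv_mul_cancel₀ hpos.ne'] using hws.hasSum.mul_left (∑' g, w g)⁻¹
    · have : ∑ s ∈ S.carrier, ∑' g, |(∑' g, w g)⁻¹ * w (g * s⁻¹) - (∑' g, w g)⁻¹ * w g| =
          (∑' g, w g)⁻¹ * D := by
        rw [hD, Finset.mul_sum]
        refine Finset.sum_congr rfl fun s _ => ?_
        rw [← tsum_mul_left]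
        refine tsum_congr fun g => ?_
        rw [← mul_sub, abs_mul, abs_of_pos (inv_pos.2 hpos)]
      rw [this, inv_mul_eq_div, div_le_div_iff₀ hpos (by positivity)]
      linarith
  choose w hw0 hw1 hwD using hex
  let a : ℕ → Set G → ℝ := fun n A => ∑' g, A.indicator (w n) g
  have has : ∀ n (A : Set G), Summable (A.indicator (w n)) := fun n A => (hw1 n).summable.indicator A
  have ha0 : ∀ n A, 0 ≤ a n A := fun n A =>
    tsum_nonneg fun g => Set.indicator_nonneg (fun g _ => hw0 n g) g
  have ha1 : ∀ n A, a n A ≤ 1 := fun n A => by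
    rw [← (hw1 n).tsum_eq]
    exact Summable.tsum_le_tsum (fun g => Set.indicator_le_self' (fun g _ => hw0 n g) g) (has n A)
      (hw1 n).summable
  let l : Ultrafilter ℕ := hyperfilter ℕ
  have hl : (l : Filter ℕ) ≤ atTop := Nat.hyperfilter_le_atTop
  have hex : ∀ A, ∃ c ∈ Set.Icc (0 : ℝ) 1, Tendsto (fun n => a n A) l (𝓝 c) := fun A => by
    refine isCompact_Icc.ultrafilter_le_nhds (l.map fun n => a n A) (le_principal_iff.2 ?_)
    rw [Ultrafilter.mem_coe, Ultrafilter.mem_map]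
    exact Filter.univ_mem' fun n => ⟨ha0 n A, ha1 n A⟩
  choose μ hμ hlim using hex
  refine isAmenable_of_right_invariant (S := S) μ (fun A => (hμ A).1) ?_ ?_ ?_
  · refine tendsto_nhds_unique (hlim _) ?_
    simp only [a, Set.indicator_univ, (hw1 _).tsum_eq]
    exact tendsto_const_nhds
  · intro A B hAB
    refine tendsto_nhds_unique (hlim _) (((hlim A).add (hlim B)).congr fun n => ?_)
    simp only [a]
    rw [← Summable.tsum_add (has n A) (has n B), Set.indicator_union_of_disjoint hAB]
  · intro s hs A
    have hshift : ∀ n, Summable fun g => w n (g * s⁻¹) := fun n =>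
      (Equiv.mulRight s⁻¹).summable_iff.2 (hw1 n).summable
    have hdiff : ∀ n, |a n {g | g * s ∈ A} - a n A| ≤ 1 / ((n : ℝ) + 1) := by
      intro n
      have h1 : a n {g | g * s ∈ A} = ∑' g, A.indicator (fun g => w n (g * s⁻¹)) g := by
        rw [← (Equiv.mulRight s).tsum_eq]
        refine tsum_congr fun g => ?_
        simp only [Set.indicator, Equiv.coe_mulRight, mul_inv_cancel_right]
        rfl
      have hsub : Summable fun g => |w n (g * s⁻¹) - w n g| :=
        ((hshift n).sub (hw1 n).summable).abs
      rw [h1, ← Summable.tsum_sub ((hshift n).indicator A) (has n A)]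
      refine le_trans ?_ (hwD n)
      refine le_trans ?_ (Finset.single_le_sum
        (f := fun s => ∑' g, |w n (g * s⁻¹) - w n g|)
        (fun _ _ => tsum_nonneg fun _ => abs_nonneg _) hs)
      have hle : ∀ g, ‖A.indicator (fun g => w n (g * s⁻¹)) g - A.indicator (w n) g‖ ≤
          |w n (g * s⁻¹) - w n g| := fun g => by
        by_cases hg : g ∈ A <;> simp [hg]
      exact tsum_of_norm_bounded hsub.hasSum hle
    have hz : Tendsto (fun n => a n {g | g * s ∈ A} - a n A) l (𝓝 0) :=
      squeeze_zero_norm (fun n => hdiff n)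
        (tendsto_one_div_add_atTop_nhds_zero_nat.mono_left hl)
    exact sub_eq_zero.1 (tendsto_nhds_unique ((hlim _).sub (hlim A)) hz)

/-- Write y + t = (1-x)·y/(1-x) + x·t/x and use convexity of the p-th power, with x so small that
(1-x)^(1-p) < 1 + ε. -/
theorem exists_add_rpow_le {p : ℝ} (hp1 : 1 ≤ p) {ε : ℝ} (hε : 0 < ε) :
    ∃ C, 0 ≤ C ∧ ∀ y t : ℝ, 0 ≤ y → 0 ≤ t → (y + t) ^ p ≤ (1 + ε) * y ^ p + C * t ^ p := by
  have h1 : ContinuousAt (fun x : ℝ => (1 - x) ^ (1 - p)) 0 :=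
    (continuousAt_const.sub continuousAt_id).rpow_const (Or.inl (by norm_num))
  have h2 : ∀ᶠ x in 𝓝[>] (0 : ℝ), (1 - x) ^ (1 - p) < 1 + ε :=
    (h1.eventually (gt_mem_nhds (by simpa))).filter_mono nhdsWithin_le_nhds
  have h3 : ∀ᶠ x in 𝓝[>] (0 : ℝ), x ∈ Set.Ioo (0 : ℝ) 1 := Ioo_mem_nhdsGT one_pos
  obtain ⟨x, hx, hx0, hx1⟩ := (h2.and h3).exists
  have hx1' : 0 < 1 - x := sub_pos.2 hx1
  refine ⟨x ^ (1 - p), by positivity, fun y t hy ht => ?_⟩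
  have h4 := (convexOn_rpow hp1).2 (show y / (1 - x) ∈ Set.Ici 0 from div_nonneg hy hx1'.le)
    (show t / x ∈ Set.Ici 0 from div_nonneg ht hx0.le) hx1'.le hx0.le (by ring)
  have key : ∀ a b : ℝ, 0 < a → 0 ≤ b → a * (b / a) ^ p = a ^ (1 - p) * b ^ p := by
    intro a b ha hb
    rw [Real.div_rpow hb ha.le, Real.rpow_sub ha, Real.rpow_one]
    ring
  simp only [smul_eq_mul] at h4
  rw [mul_div_cancel₀ _ hx1'.ne', mul_div_cancel₀ _ hx0.ne', key _ _ hx1' hy, key _ _ hx0 ht] at h4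
  refine h4.trans ?_
  gcongr

theorem exists_abs_rpow_sub_rpow_le {p : ℝ} (hp1 : 1 ≤ p) {ε : ℝ} (hε : 0 < ε) :
    ∃ C, 0 ≤ C ∧ ∀ a b : ℂ, |‖a‖ ^ p - ‖b‖ ^ p| ≤ ε * (‖a‖ ^ p + ‖b‖ ^ p) + C * ‖a - b‖ ^ p := by
  obtain ⟨C, hC, h⟩ := exists_add_rpow_le hp1 hε
  refine ⟨C, hC, ?_⟩
  have key : ∀ a b : ℂ, ‖a‖ ^ p - ‖b‖ ^ p ≤ ε * (‖a‖ ^ p + ‖b‖ ^ p) + C * ‖a - b‖ ^ p := by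
    intro a b
    have h1 : ‖a‖ ≤ ‖b‖ + ‖a - b‖ := by simpa using norm_add_le b (a - b)
    have h2 := (Real.rpow_le_rpow (norm_nonneg _) h1 (zero_le_one.trans hp1)).trans
      (h _ _ (norm_nonneg b) (norm_nonneg (a - b)))
    have h3 : 0 ≤ ε * ‖a‖ ^ p := by positivity
    linarith
  intro a b
  refine abs_le.2 ⟨?_, key a b⟩
  have := key b a
  rw [norm_sub_rev] at this
  linarith

/-- The `ℓ^p` isoperimetric inequality of a nonamenable group. -/
theorem exists_pSum_isoperimetric (hG : ¬ IsAmenable G) (p : ℝ) [hp : Fact (1 ≤ p)] :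
    ∃ C, 0 < C ∧ ∀ u : G → ℂ, PSummable p u →
      pSum p u ≤ C * ∑ s ∈ S.carrier, pSum p (diff s u) := by
  obtain ⟨C, hC, hiso⟩ := exists_l1_isoperimetric S hG
  set N : ℝ := ((S.carrier.card : ℕ) : ℝ) with hN
  -- The ℓ^1 inequality is applied to |u|^p. This ε leaves at most half of `pSum p u` on the right,
  -- which is absorbed on the left and gives the constant 2CK.
  obtain ⟨K, hK, hKle⟩ := exists_abs_rpow_sub_rpow_le hp.out
    (show 0 < 1 / (4 * (C + 1) * (N + 1)) by positivity)
  refine ⟨2 * C * K + 1, by positivity, fun u hu => ?_⟩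
  set D := ∑ s ∈ S.carrier, pSum p (diff s u) with hD
  have hD0 : 0 ≤ D := Finset.sum_nonneg fun _ _ => pSum_nonneg _
  have h1 := hiso (fun g => ‖u g‖ ^ p) (fun g => by positivity) hu
  set ε := 1 / (4 * (C + 1) * (N + 1)) with hε
  have h2 : ∑ s ∈ S.carrier, ∑' g, |‖u (g * s⁻¹)‖ ^ p - ‖u g‖ ^ p| ≤
      ∑ s ∈ S.carrier, (ε * (pSum p u + pSum p u) + K * pSum p (diff s u)) := by
    refine Finset.sum_le_sum fun s _ => ?_
    have hus : Summable fun g => ‖u (g * s⁻¹)‖ ^ p := hu.translate s⁻¹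
    have hds : Summable fun g => ‖diff s u g‖ ^ p := hu.diff s
    have hsum : pSum p u = ∑' g, ‖u (g * s⁻¹)‖ ^ p :=
      ((Equiv.mulRight s⁻¹).tsum_eq fun g => ‖u g‖ ^ p).symm
    nth_rewrite 1 [hsum]
    simp only [pSum]
    rw [← Summable.tsum_add hus hu, ← tsum_mul_left, ← tsum_mul_left,
      ← Summable.tsum_add ((hus.add hu).mul_left _) (hds.mul_left _)]
    exact Summable.tsum_le_tsum (fun g => hKle _ _) ((hus.sub hu).abs)
      (((hus.add hu).mul_left _).add (hds.mul_left _))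
  rw [Finset.sum_add_distrib, Finset.sum_const, nsmul_eq_mul, ← Finset.mul_sum, ← hD, ← hN] at h2
  have h3 : pSum p u ≤ C * (N * (ε * (pSum p u + pSum p u)) + K * D) :=
    h1.trans (mul_le_mul_of_nonneg_left h2 hC)
  have h4 : C * (N * ε) ≤ 1 / 4 := by
    have hN0 : 0 ≤ N := Nat.cast_nonneg _
    rw [hε, mul_one_div, mul_div_assoc', div_le_div_iff₀ (by positivity) (by norm_num)]
    nlinarith [mul_nonneg hC hN0]
  have h5 : 0 ≤ pSum p u := pSum_nonneg u
  have h6 : C * (N * ε) * pSum p u ≤ 1 / 4 * pSum p u := mul_le_mul_of_nonneg_right h4 h5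
  nlinarith

end Amenability

/-! ### The spectral gap on ℓ^p and arbitrary invariant functionals. -/

section Averaging

variable {G : Type*} [Group G] {S : SymmGenSet G} {p : ℝ} [hp : Fact (1 ≤ p)]

instance : Fact (1 ≤ ENNReal.ofReal p) := ⟨ENNReal.one_le_ofReal.2 hp.out⟩

/-- The Banach space `ℓ^p(G)`. -/
abbrev EllP (G : Type*) (p : ℝ) : Type _ := lp (fun _ : G => ℂ) (ENNReal.ofReal p)

theorem EllP.pSummable (x : EllP G p) : PSummable p (x : G → ℂ) :=
  (pSummable_iff_memlp p _).2 x.2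

theorem EllP.norm_rpow (x : EllP G p) : ‖x‖ ^ p = pSum p (x : G → ℂ) := by
  have h0 : 0 < p := lt_of_lt_of_le one_pos hp.out
  have h1 : (ENNReal.ofReal p).toReal = p := ENNReal.toReal_ofReal h0.le
  have := lp.norm_rpow_eq_tsum (by rw [h1]; exact h0) x
  rwa [h1] at this

/-- Right translation on `ℓ^p(G)`. -/
def EllP.translate (s : G) : EllP G p →L[ℂ] EllP G p :=
  LinearMap.mkContinuous
    { toFun := fun x => ⟨fun g => x (g * s⁻¹),
        (pSummable_iff_memlp p _).1 (x.pSummable.translate s⁻¹)⟩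
      map_add' := fun _ _ => rfl
      map_smul' := fun _ _ => rfl } 1 fun x => by
    have h0 : 0 < p := lt_of_lt_of_le one_pos hp.out
    rw [one_mul, ← Real.rpow_le_rpow_iff (norm_nonneg _) (norm_nonneg _) h0, EllP.norm_rpow,
      EllP.norm_rpow]
    exact ((Equiv.mulRight s⁻¹).tsum_eq fun g => ‖x g‖ ^ p).le

theorem EllP.norm_translate (s : G) (x : EllP G p) : ‖EllP.translate s x‖ = ‖x‖ := by
  have h0 : 0 < p := lt_of_lt_of_le one_pos hp.out
  rw [← Real.rpow_left_inj (norm_nonneg _) (norm_nonneg _) h0.ne', EllP.norm_rpow, EllP.norm_rpow]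
  exact (Equiv.mulRight s⁻¹).tsum_eq fun g => ‖x g‖ ^ p

variable (S p) in
/-- The average of the operators `(1 + R_s) / 2`, where `R_s` is right translation by `s ∈ S`. -/
def averaging : EllP G p →L[ℂ] EllP G p :=
  (S.carrier.card : ℂ)⁻¹ • ∑ s ∈ S.carrier,
    (1 / 2 : ℂ) • (EllP.translate s + ContinuousLinearMap.id ℂ (EllP G p))

theorem averaging_apply (x : EllP G p) : averaging S p x =
    (S.carrier.card : ℂ)⁻¹ • ∑ s ∈ S.carrier, (1 / 2 : ℂ) • (EllP.translate s x + x) := by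
  simp [averaging]

theorem card_carrier_pos [Infinite G] (S : SymmGenSet G) : 0 < S.carrier.card := by
  refine Finset.card_pos.2 (Finset.nonempty_iff_ne_empty.2 fun h => ?_)
  have h1 := S.closure_eq_top
  rw [h, Finset.coe_empty, Subgroup.closure_empty] at h1
  exact bot_ne_top h1

/-- A nonamenable group has a spectral gap on `ℓ^p`. -/
theorem norm_averaging_lt_one [Infinite G] (hG : ¬ IsAmenable G) (hp1 : 1 < p) :
    ‖averaging S p‖ < 1 := by
  have h0 : 0 < p := one_pos.trans hp1
  obtain ⟨C, hC, hiso⟩ := exists_pSum_isoperimetric S hG p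
  set n : ℝ := ((S.carrier.card : ℕ) : ℝ) with hn
  have hn1 : 1 ≤ n := by
    rw [hn]
    exact_mod_cast card_carrier_pos S
  have hn0 : 0 < n := one_pos.trans_le hn1
  -- By the isoperimetric inequality x is far from some of its translates, so by convexity the
  -- midpoints `H s x` lose norm. With P = ‖x‖^p and Q = ∑ ‖H s x‖^p, this ε gives P ≤ P/2 + CK(nP -
  -- Q), hence nP - Q ≥ δP.
  obtain ⟨K, hK, hconv⟩ := exists_pSum_uniform_convexity (p := p) hp1
    (show 0 < 1 / (4 * n * C) by positivity)
  set δ : ℝ := 1 / (2 * (C * K + 1)) with hδ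
  have hδ0 : 0 < δ := by positivity
  have hδ1 : δ < 1 := by
    rw [hδ, div_lt_one (by positivity)]
    nlinarith [mul_nonneg hC.le hK]
  let H : G → EllP G p → EllP G p := fun s x => (1 / 2 : ℂ) • (EllP.translate s x + x)
  have hH : ∀ x : EllP G p, ∑ s ∈ S.carrier, ‖H s x‖ ^ p ≤ (n - δ) * ‖x‖ ^ p := by
    intro x
    have hHle : ∀ s, ‖H s x‖ ^ p ≤ ‖x‖ ^ p := fun s => by
      refine Real.rpow_le_rpow (norm_nonneg _) ?_ h0.le
      rw [norm_smul]
      have h1 := norm_add_le (EllP.translate s x) x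
      rw [EllP.norm_translate] at h1
      norm_num
      linarith
    have h1 : ∀ s ∈ S.carrier, pSum p (diff s x) ≤ 1 / (4 * n * C) * (‖x‖ ^ p + ‖x‖ ^ p) +
        K * (‖x‖ ^ p - ‖H s x‖ ^ p) := by
      intro s _
      have h2 := hconv G (EllP.translate s x) x (EllP.translate s x).pSummable x.pSummable
      rw [← EllP.norm_rpow, ← EllP.norm_rpow, EllP.norm_translate, add_self_div_two] at h2
      have h3 : pSum p ((1 / 2 : ℂ) • ((EllP.translate s x : G → ℂ) + (x : G → ℂ))) = ‖H s x‖ ^ p :=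
        (EllP.norm_rpow (H s x)).symm
      rw [h3] at h2
      exact h2
    have h2 := hiso x x.pSummable
    have h3 := h2.trans (mul_le_mul_of_nonneg_left (Finset.sum_le_sum h1) hC.le)
    rw [← EllP.norm_rpow, Finset.sum_add_distrib, ← Finset.mul_sum, ← Finset.mul_sum,
      Finset.sum_const, Finset.sum_sub_distrib, Finset.sum_const, nsmul_eq_mul, nsmul_eq_mul, ← hn] at h3
    have h4 : 0 ≤ n * ‖x‖ ^ p - ∑ s ∈ S.carrier, ‖H s x‖ ^ p := by
      rw [sub_nonneg, hn, ← nsmul_eq_mul]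
      exact Finset.sum_le_card_nsmul _ _ _ fun s _ => hHle s
    set P := ‖x‖ ^ p
    set Q := ∑ s ∈ S.carrier, ‖H s x‖ ^ p
    have h5 : C * (1 / (4 * n * C) * (n * (P + P)) + K * (n * P - Q)) =
        P / 2 + C * K * (n * P - Q) := by
      field_simp; ring
    rw [h5] at h3
    have h6 : δ * P ≤ n * P - Q := by
      rw [hδ, div_mul_eq_mul_div, one_mul, div_le_iff₀ (by positivity)]
      nlinarith
    linarith
  set θ : ℝ := 1 - δ / n with hθ
  have hδn : 0 < δ / n ∧ δ / n < 1 := ⟨by positivity, by rw [div_lt_one hn0]; linarith⟩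
  have hθ0 : 0 ≤ θ := by linarith
  have hθ1 : θ < 1 := by linarith
  refine lt_of_le_of_lt ?_ (Real.rpow_lt_one hθ0 hθ1 (show 0 < 1 / p by positivity))
  refine ContinuousLinearMap.opNorm_le_bound _ (by positivity) fun x => ?_
  rw [← Real.rpow_le_rpow_iff (norm_nonneg _) (by positivity) h0,
    Real.mul_rpow (by positivity) (norm_nonneg _), ← Real.rpow_mul hθ0,
    one_div_mul_cancel h0.ne', Real.rpow_one]
  have h1 : ‖averaging S p x‖ ≤ ∑ s ∈ S.carrier, n⁻¹ * ‖H s x‖ := by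
    rw [averaging_apply, norm_smul, norm_inv, Complex.norm_natCast, ← Finset.mul_sum]
    gcongr
    exact norm_sum_le _ _
  have h2 := Real.rpow_arith_mean_le_arith_mean_rpow S.carrier (fun _ => n⁻¹) (fun s => ‖H s x‖)
    (fun _ _ => by positivity)
    (by rw [Finset.sum_const, nsmul_eq_mul, ← hn, mul_inv_cancel₀ hn0.ne'])
    (fun _ _ => norm_nonneg _) hp1.le
  refine (Real.rpow_le_rpow (norm_nonneg _) h1 h0.le).trans (h2.trans ?_)
  rw [← Finset.mul_sum]
  refine (mul_le_mul_of_nonneg_left (hH x) (by positivity)).trans (le_of_eq ?_)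
  rw [hθ]; field_simp

/-- In a nonamenable group every element of `ℓ^p` is a combination of differences of
translates. -/
theorem exists_eq_sum_sub_translate [Infinite G] (hG : ¬ IsAmenable G) (hp1 : 1 < p)
    (x : EllP G p) : ∃ y : EllP G p, x = ∑ s ∈ S.carrier, (EllP.translate s y - y) := by
  obtain ⟨B, hB⟩ :=
    (isUnit_one_sub_of_norm_lt_one (norm_averaging_lt_one (S := S) hG hp1)).exists_right_inv
  have hn : (S.carrier.card : ℂ) ≠ 0 := Nat.cast_ne_zero.2 (card_carrier_pos S).ne'
  have h1 : B x - averaging S p (B x) = x := by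
    have := congrArg (fun T : EllP G p →L[ℂ] EllP G p => T x) hB
    simpa using this
  -- The witness comes from 1 - (1 + R_s)/2 = -(R_s - 1)/2, averaged over `S` and applied to B x,
  -- where B inverts 1 minus the averaging operator.
  refine ⟨(-(1 / 2 : ℂ) * (S.carrier.card : ℂ)⁻¹) • B x, ?_⟩
  have h2 : ∑ s ∈ S.carrier, (1 / 2 : ℂ) • (EllP.translate s (B x) + B x) =
      (1 / 2 : ℂ) • ∑ s ∈ S.carrier, (EllP.translate s (B x) - B x) +
        (S.carrier.card : ℂ) • B x := by
    rw [Nat.cast_smul_eq_nsmul, ← Finset.sum_const, Finset.smul_sum, ← Finset.sum_add_distrib]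
    exact Finset.sum_congr rfl fun s _ => by module
  simp only [map_smul, ← smul_sub, ← Finset.smul_sum]
  nth_rewrite 1 [← h1]
  rw [averaging_apply, h2, smul_add, inv_smul_smul₀ hn, sub_add_cancel_right, smul_smul, ← neg_smul]
  congr 1
  ring

/-- The inclusion of `ℓ^p(G)` in `D_p(G)`. -/
def EllP.toDp (S : SymmGenSet G) (p : ℝ) [hp : Fact (1 ≤ p)] : EllP G p →ₗ[ℂ] Dp S p where
  toFun x := Dp.of x x.pSummable.mem_dirichlet
  map_add' _ _ := rfl
  map_smul' _ _ := rfl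

theorem EllP.toDp_mem_ellp (x : EllP G p) : EllP.toDp S p x ∈ ellp S p := x.pSummable

theorem exists_toDp_eq {f : Dp S p} (hf : f ∈ ellp S p) : ∃ x, EllP.toDp S p x = f :=
  ⟨⟨f.fn, (pSummable_iff_memlp p _).1 hf⟩, rfl⟩

theorem EllP.norm_toDp_le (x : EllP G p) :
    ‖EllP.toDp S p x‖ ≤ (S.carrier.card * (2 ^ p * 2) + 1) ^ (1 / p) * ‖x‖ := by
  have h0 : 0 < p := lt_of_lt_of_le one_pos hp.out
  rw [← Real.rpow_le_rpow_iff (norm_nonneg _) (by positivity) h0,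
    Real.mul_rpow (by positivity) (norm_nonneg _), ← Real.rpow_mul (by positivity),
    one_div_mul_cancel h0.ne', Real.rpow_one, Dp.norm_rpow, EllP.norm_rpow]
  have h1 := energy_le_mul_pSum (EllP.toDp_mem_ellp (S := S) x)
  have h2 := norm_rpow_le_pSum x.pSummable 1
  change energy _ ≤ _ * (_ * (pSum p (x : G → ℂ) + pSum p (x : G → ℂ))) at h1
  change _ + ‖(x : G → ℂ) 1‖ ^ p ≤ _
  linarith

/-- In a nonamenable group `ℓ^p` is closed in `D_p`. -/
theorem nullSpace_le_ellp (hG : ¬ IsAmenable G) : nullSpace S p ≤ ellp S p := by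
  have h0 : 0 < p := lt_of_lt_of_le one_pos hp.out
  obtain ⟨C, hC, hiso⟩ := exists_pSum_isoperimetric S hG p
  let ι : EllP G p →L[ℂ] Dp S p := (EllP.toDp S p).mkContinuous _ EllP.norm_toDp_le
  -- The isoperimetric inequality says that the inclusion is bounded below; since ℓ^p is complete,
  -- its range is closed.
  have hanti : AntilipschitzWith (C ^ (1 / p)).toNNReal ι := by
    refine ContinuousLinearMap.antilipschitz_of_bound ι fun x => ?_
    rw [Real.coe_toNNReal _ (by positivity),
      ← Real.rpow_le_rpow_iff (norm_nonneg _) (by positivity) h0,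
      Real.mul_rpow (by positivity) (norm_nonneg _), ← Real.rpow_mul hC.le,
      one_div_mul_cancel h0.ne', Real.rpow_one, EllP.norm_rpow]
    refine (hiso x x.pSummable).trans ?_
    gcongr
    exact energy_le_norm_rpow (EllP.toDp S p x)
  have hcl : IsClosed (Set.range ι) := hanti.isClosed_range ι.uniformContinuous
  intro f hf
  obtain ⟨x, rfl⟩ := closure_minimal (fun u hu => exists_toDp_eq (finSupp_subset_ellp hu)) hcl hf
  exact EllP.toDp_mem_ellp x

/-- Modulo constants every function is in ℓ^p, hence a finite sum of differences R_s y - y.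
Invariance kills these algebraically, which is why continuity is not needed. -/
theorem IsTILF.eq_zero_of_not_isAmenable [Infinite G] (hG : ¬ IsAmenable G) (hp1 : 1 < p)
    (h : nullSpace S p ⊔ constants S p = ⊤) {T : DpModC S p →ₗ[ℂ] ℂ} (hT : IsTILF T) : T = 0 := by
  refine LinearMap.ext fun q => ?_
  obtain ⟨f, rfl⟩ := (constants S p).mkQ_surjective q
  obtain ⟨b, hb, k, hk, rfl⟩ := Submodule.mem_sup.1 (h ▸ Submodule.mem_top : f ∈ _)
  have hk0 : (constants S p).mkQ k = 0 := (Submodule.Quotient.mk_eq_zero _).2 hk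
  rw [map_add, hk0, add_zero]
  obtain ⟨x, rfl⟩ := exists_toDp_eq (nullSpace_le_ellp hG hb)
  obtain ⟨y, rfl⟩ := exists_eq_sum_sub_translate (S := S) hG hp1 x
  rw [LinearMap.zero_apply]
  simp only [map_sum, map_sub]
  exact Finset.sum_eq_zero fun s _ => sub_eq_zero.2 (hT s (EllP.toDp S p y))

end Averaging

end PHarmonic

end

theorem mainTheorem8 {G : Type*} [Group G] [Infinite G] (S : PHarmonic.SymmGenSet G)
    (p : ℝ) [Fact (1 ≤ p)] (hp : 1 < p) :
    List.TFAE
      [Subsingleton (PHarmonic.reducedH1 S p),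
        PHarmonic.harmonicBoundary S p = ∅ ∨ ∃ x, PHarmonic.harmonicBoundary S p = {x},
        PHarmonic.HDp S p = {f | ∃ c : ℂ, f = fun _ => c},
        PHarmonic.BHDp S p = {f | ∃ c : ℂ, f = fun _ => c},
        ∀ T : PHarmonic.DpModC S p →ₗ[ℂ] ℂ, PHarmonic.IsTILF T → Continuous T → T = 0] ∧
    (¬ PHarmonic.IsAmenable G →
      (Subsingleton (PHarmonic.reducedH1 S p) ↔
        ∀ T : PHarmonic.DpModC S p →ₗ[ℂ] ℂ, PHarmonic.IsTILF T → T = 0)) := by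
  rw [PHarmonic.subsingleton_reducedH1_iff]
  refine ⟨?_, fun hG => ⟨fun h T hT => hT.eq_zero_of_not_isAmenable hG hp h,
    fun h => PHarmonic.sup_eq_top_of_tilf fun T hT _ => h T hT⟩⟩
  tfae_have 1 → 2 := fun h => (PHarmonic.harmonicBoundary_subsingleton h).eq_empty_or_singleton
  tfae_have 2 → 1 := fun h => PHarmonic.sup_eq_top_of_harmonicBoundary_subsingleton <| by
    rcases h with h | ⟨x, h⟩
    · exact h ▸ Set.subsingleton_empty
    · exact h ▸ Set.subsingleton_singleton
  tfae_have 1 → 3 := PHarmonic.HDp_eq_of_sup_eq_top hp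
  tfae_have 3 → 4 := PHarmonic.BHDp_eq_of_HDp_eq
  tfae_have 4 → 1 := PHarmonic.sup_eq_top_of_BHDp_eq hp
  tfae_have 1 → 5 := fun h T hT hc => hT.eq_zero_of_continuous hp h hc
  tfae_have 5 → 1 := PHarmonic.sup_eq_top_of_tilf
  tfae_finish
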